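/- **Setting.** Let $d,p,q,n\ge 1$ be integers and let $D=\{0=t_0<\dots<t_K=1\}$ be a sampling grid with mesh $|D|=\max_{0\le k<K}(t_{k+1}-t_k)$. Let $\sigma:\mathbb R\to\mathbb R$ be $L_\sigma$-Lipschitz with $\sigma(0)=0$ and a constant $L_\sigma\ge 1$; it acts entrywise. For parameters $\theta=(\Phi,A_1,\dots,A_q,b_1,\dots,b_q,U,v)$ with $\Phi,v\in\mathbb R^p$, $U\in\mathbb R^{p\times d}$, $A_h\in\mathbb R^{p\times p}$ and $b_h\in\mathbb R^p$ for $h<q$, $A_q:\mathbb R^p\to\mathbb R^{p\times d}$ linear and $b_q\in\mathbb R^{p\times d}$, define the deep feed-forward neural vector field $$G_\theta(z)=\sigma\big(A_q\,\sigma(A_{q-1}\cdots\sigma(A_1z+b_1)\cdots+b_{q-1})+b_q\big)\in\mathbb R^{p\times d}.$$ For a time series $\mathbf x^D=(\mathbf x_{t_0},\dots,\mathbf x_{t_K})$ in $\mathbb R^d$, the NCDE driven by its fill-forward embedding (the path equal to the last value observed) has the piecewise constant latent trajectory $z^D_{t_0}=\sigma(U\mathbf x_{t_0}+v)$, $z^D_{t_{k+1}}=z^D_{t_k}+G_\theta(z^D_{t_k})(\mathbf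 x_{t_{k+1}}-\mathbf x_{t_k})$ for $0\le k<K$; the prediction is $f_\theta(\mathbf x^D)=\Phi^\top z^D_1$. Let $\Theta$ be the set of all $\theta$ with $\|\Phi\|\le B_\Phi$, $\|A_h\|\le B_A$, $\|b_h\|\le B_b$ ($1\le h\le q$), $\|U\|\le B_U$, $\|v\|\le B_v$ (Frobenius norms, all bounds nonnegative). **Data and loss.** Let $(y^i,\mathbf x^{D,i})_{i\le n}$ be i.i.d. copies of $(y,\mathbf x^D)$, where a.s. each $\mathbf x^{D,i}$ is the discretization on $D$ of a path $x^i:[0,1]\to\mathbb R^d$ that is $L_x$-Lipschitz with $\|x^i_0\|\le B_x$, and $|y|\le B_y$ a.s. Put $$a=L_\sigma B_A,\qquad \beta_h=L_\sigma B_b\sum_{j=0}^{h-1}a^j=L_\sigma B_b\tfrac{a^h-1}{a-1},\qquad R=L_\sigma(1+a^qL_x|D|)^K(B_UB_x+B_v+\beta_qL_x),\qquad M_\Theta^D=B_\Phi R .$$ The measurable loss $\ell\ge 0$ satisfies $|\ell(y,u)-\ell(y,u')|\le L_\ell|u-u'|$ and $\ell(y,u)\le M_\ell$ whenever $|y|\le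 B_y$ and $|u|,|u'|\le M_\Theta^D$. Let $\mathcal R^D_n(f_\theta)=\frac1n\sum_{i}\ell(y^i,f_\theta(\mathbf x^{D,i}))$, $\mathcal R^D(f_\theta)=\mathbb E[\ell(y,f_\theta(\mathbf x^{D}))]$, and let $\hat f^D=f_{\hat\theta}$ be a minimizer of $\mathcal R^D_n$ over $\theta\in\Theta$. **Constants.** Let $E=e^{a^qL_x}$ and $$C_A^D=B_\Phi L_xE\max_{1\le j\le q}a^{q-j}L_\sigma(a^{j-1}R+\beta_{j-1}),\quad C_b^D=B_\Phi L_xE\max_{1\le j\le q}a^{q-j}L_\sigma,\quad C_U=B_\Phi B_xEL_\sigma,\quad C_v=B_\Phi EL_\sigma,$$ $$K_1^D=\max\{B_\Phi R,\;B_vC_v\},\qquad K_2^D=\max\{B_bC_b^D,\;B_AC_A^D,\;B_UC_U\},\qquad C_q=8q+12,$$ $$U_1^D=\log(\sqrt n\,C_qK_1^D),\qquad U_2^D=\log(\sqrt{np}\,C_qK_2^D),\qquad U_3^D=\log(\sqrt{ndp}\,C_qK_2^D).$$ **Theorem.** Let $n$ be large enough that $\frac1{\sqrt n}\le 2M_\Theta^D$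 and $\frac1{\sqrt n}\le(4q+6)\sqrt p\,K_2^D$. Then for every $\delta\in(0,1)$, with probability at least $1-\delta$, $$\mathcal R^D(\hat f^D)-\mathcal R_n^D(\hat f^D)\le\frac{24M_\Theta^DL_\ell}{\sqrt n}\sqrt{2pU_1^D+(q-1)p(p+1)U_2^D+dp(2+p)U_3^D}+M_\ell\sqrt{\frac{\log(1/\delta)}{2n}}.$$ -/

import Mathlib

open MeasureTheory ProbabilityTheory

namespace NCDE

/-- The Euclidean space of dimension `m`. -/
abbrev Vec (m : ℕ) : Type := EuclideanSpace ℝ (Fin m)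

/-! ### Sampling grids and the fill-forward embedding -/

/-- A sampling grid `0 = t_0 < t_1 < ⋯ < t_K = 1` of the unit interval. -/
structure Grid (K : ℕ) where
  t : Fin (K + 1) → ℝ
  strictMono : StrictMono t
  t_zero : t 0 = 0
  t_last : t (Fin.last K) = 1

namespace Grid

variable {K : ℕ} (D : Grid K)

/-- The mesh `|D|`: the greatest gap between two consecutive sampling times. -/
noncomputable def mesh : ℝ := ⨆ k : Fin K, (D.t k.succ - D.t k.castSucc)

open Classical in
/-- The index of the last sampling time that is at most `s`. -/
noncomputable def lastIndex (s : ℝ) : Fin (K + 1) :=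
  (Finset.univ.filter fun k => D.t k ≤ s).sup id

/-- The fill-forward embedding of a time series: the path which at time `s` has the last value
observed up to time `s`. -/
noncomputable def fillForward {E : Type*} (x : Fin (K + 1) → E) : ℝ → E :=
  fun s => x (D.lastIndex s)

/-- The time series obtained by observing a path at the sampling times. -/
def sample {E : Type*} (x : ℝ → E) : Fin (K + 1) → E := fun k => x (D.t k)

theorem lastIndex_t (k : Fin (K + 1)) : D.lastIndex (D.t k) = k := by
  classical
  apply le_antisymm
  · refine Finset.sup_le fun j hj => ?_
    exact D.strictMono.le_iff_le.1 (Finset.mem_filter.1 hj).2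
  · exact Finset.le_sup (f := id) (Finset.mem_filter.2 ⟨Finset.mem_univ k, le_refl _⟩)

theorem lastIndex_of_mem (k : Fin K) {s : ℝ} (h₁ : D.t k.castSucc ≤ s) (h₂ : s < D.t k.succ) :
    D.lastIndex s = k.castSucc := by
  classical
  apply le_antisymm
  · refine Finset.sup_le fun j hj => ?_
    have h := D.strictMono.lt_iff_lt.1 (lt_of_le_of_lt (Finset.mem_filter.1 hj).2 h₂)
    exact Fin.le_castSucc_iff.2 h
  · exact Finset.le_sup (f := id) (Finset.mem_filter.2 ⟨Finset.mem_univ _, h₁⟩)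

end Grid

/-! ### The model -/

/-- The parameters `θ = (Φ, ψ, ξ)` of a neural controlled differential equation with a deep
feed-forward vector field of depth `q ≥ 1`, input dimension `d` and latent dimension `p`.
The first `q - 1` layers map `ℝ^p` to `ℝ^p`, the `q`-th maps `ℝ^p` to `ℝ^{p × d}`. -/
structure Param (d p q : ℕ) where
  /-- linear readout `Φ` -/
  readout : Vec p
  /-- weights `A_1, …, A_{q-1}` -/
  A : Fin (q - 1) → Matrix (Fin p) (Fin p) ℝ
  /-- biases `b_1, …, b_{q-1}` -/
  b : Fin (q - 1) → Vec p
  /-- weight `A_q` of the last layer, a linear operator from `ℝ^p` to `ℝ^{p × d}` -/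
  Alast : Matrix (Fin p × Fin d) (Fin p) ℝ
  /-- bias `b_q` of the last layer -/
  blast : Matrix (Fin p) (Fin d) ℝ
  /-- weight `U` of the initialization network -/
  U : Matrix (Fin p) (Fin d) ℝ
  /-- bias `v` of the initialization network -/
  v : Vec p

namespace Param

variable {d p q K : ℕ} (σ : ℝ → ℝ) (θ : Param d p q) (D : Grid K)

/-- The output of the first `h` layers, `h = 0, …, q - 1`, at `z`. -/
noncomputable def hidden (z : Vec p) : Fin (q - 1 + 1) → Vec p :=
  Fin.induction (motive := fun _ => Vec p) z fun h u =>
    WithLp.toLp 2 fun i => σ ((θ.A h).mulVec u.ofLp i + θ.b h i)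

/-- The neural vector field `G_ψ : ℝ^p → ℝ^{p × d}`. -/
noncomputable def vectorField (z : Vec p) : Matrix (Fin p) (Fin d) ℝ :=
  fun i j => σ (θ.Alast.mulVec (θ.hidden σ z (Fin.last (q - 1))).ofLp (i, j) + θ.blast i j)

/-- The initial latent state `σ(U u + v)`. -/
noncomputable def init (u : Vec d) : Vec p :=
  WithLp.toLp 2 fun i => σ (θ.U.mulVec u.ofLp i + θ.v i)

/-- The latent states at the sampling times, for a driving path `u` that is constant between
them: `z_{t_0} = σ(U u_0 + v)` and
`z_{t_{k+1}} = z_{t_k} + G_ψ(z_{t_k}) (u_{t_{k+1}} - u_{t_k})`. -/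
noncomputable def latentGrid (u : ℝ → Vec d) : Fin (K + 1) → Vec p :=
  Fin.induction (motive := fun _ => Vec p) (θ.init σ (u 0)) fun k z =>
    z + WithLp.toLp 2 ((θ.vectorField σ z).mulVec (u (D.t k.succ) - u (D.t k.castSucc)).ofLp)

/-- The piecewise constant latent trajectory `z^D` driven by the fill-forward embedding of the
time series `x`. -/
noncomputable def latent (x : Fin (K + 1) → Vec d) : ℝ → Vec p :=
  fun s => θ.latentGrid σ D (D.fillForward x) (D.lastIndex s)

/-- The prediction `f_θ(x^D) = Φᵀ z^D_1`. -/
noncomputable def predict (x : Fin (K + 1) → Vec d) : ℝ :=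
  inner ℝ θ.readout (θ.latent σ D x 1)

end Param

/-! ### The parameter space and the constants -/

/-- The real constants of the problem: a Lipschitz constant of the activation function, one of
the paths, a bound on their initial values, and the bounds on the parameters. -/
structure Consts where
  Lσ : ℝ
  Lx : ℝ
  Bx : ℝ
  BΦ : ℝ
  BA : ℝ
  Bb : ℝ
  BU : ℝ
  Bv : ℝ

namespace Consts

variable (c : Consts)

section
open scoped Matrix.Norms.Frobenius

/-- The bounded parameter space `Θ`; matrices carry the Frobenius norm. -/
def paramSpace (d p q : ℕ) : Set (Param d p q) :=
  {θ | ‖θ.readout‖ ≤ c.BΦ ∧ (∀ h, ‖θ.A h‖ ≤ c.BA) ∧ (∀ h, ‖θ.b h‖ ≤ c.Bb) ∧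
    ‖θ.Alast‖ ≤ c.BA ∧ ‖θ.blast‖ ≤ c.Bb ∧ ‖θ.U‖ ≤ c.BU ∧ ‖θ.v‖ ≤ c.Bv}

end

/-- `α_h = (L_σ B_A)^h`. -/
def α (h : ℕ) : ℝ := (c.Lσ * c.BA) ^ h

/-- `β_h = L_σ B_b ((L_σ B_A)^h - 1) / (L_σ B_A - 1)`, the quotient being the geometric sum
(also when `L_σ B_A = 1`). The value `β_q` is `κ_Θ(0)`. -/
def β (h : ℕ) : ℝ := c.Lσ * c.Bb * ∑ j ∈ Finset.range h, (c.Lσ * c.BA) ^ j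

variable {K : ℕ} (D : Grid K) (q : ℕ)

/-- The radius of the ball `Ω^D`, a bound on the latent states at the sampling times:
`L_σ (1 + (L_σ B_A)^q L_x |D|)^K (B_U B_x + B_v + κ_Θ(0) L_x)`. -/
noncomputable def radius : ℝ :=
  c.Lσ * (1 + c.α q * c.Lx * D.mesh) ^ K * (c.BU * c.Bx + c.Bv + c.β q * c.Lx)

/-- `M_Θ^D = B_Φ L_σ (1 + (L_σ B_A)^q L_x |D|)^K (B_U B_x + B_v + κ_Θ(0) L_x)`. -/
noncomputable def M : ℝ := c.BΦ * c.radius D q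

/-- The Lipschitz constant `C_A^D` of the predictions with respect to each weight. The layer
`j + 1` contributes `(L_σ B_A)^{q-1-j} L_σ (α_j ‖z‖ + β_j)`, whose maximum over the ball `Ω^D` is
attained at `‖z‖ = radius`. -/
noncomputable def CA : ℝ :=
  c.BΦ * c.Lx * Real.exp (c.α q * c.Lx) *
    ⨆ j : Fin q, c.α (q - 1 - j) * c.Lσ * (c.α j * c.radius D q + c.β j)

/-- The Lipschitz constant `C_b^D` with respect to each bias. -/
noncomputable def Cb : ℝ :=
  c.BΦ * c.Lx * Real.exp (c.α q * c.Lx) * ⨆ j : Fin q, c.α (q - 1 - j) * c.Lσ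

/-- The Lipschitz constant `C_U`. -/
noncomputable def CU : ℝ := c.BΦ * c.Bx * Real.exp (c.α q * c.Lx) * c.Lσ

/-- The Lipschitz constant `C_v`. -/
noncomputable def Cv : ℝ := c.BΦ * Real.exp (c.α q * c.Lx) * c.Lσ

/-- `K_1^D`. -/
noncomputable def K₁ : ℝ := max (c.BΦ * c.radius D q) (c.Bv * c.Cv q)

/-- `K_2^D`. -/
noncomputable def K₂ : ℝ := max (c.Bb * c.Cb q) (max (c.BA * c.CA D q) (c.BU * c.CU q))

variable (n d p : ℕ)

/-- `C_q = 8 q + 12`. -/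
def Cq (q : ℕ) : ℝ := 8 * q + 12

/-- `U_1^D`. -/
noncomputable def U₁ : ℝ := Real.log (√n * Cq q * c.K₁ D q)

/-- `U_2^D`. -/
noncomputable def U₂ : ℝ := Real.log (√(n * p) * Cq q * c.K₂ D q)

/-- `U_3^D`. -/
noncomputable def U₃ : ℝ := Real.log (√(n * d * p) * Cq q * c.K₂ D q)

/-- `2p U_1^D + (q-1) p (p+1) U_2^D + d p (2+p) U_3^D`. -/
noncomputable def complexity : ℝ :=
  2 * p * c.U₁ D q n + ((q : ℝ) - 1) * p * (p + 1) * c.U₂ D q n p +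
    d * p * (2 + p) * c.U₃ D q n d p

end Consts

/-! ### Risks -/

variable {d p q K n : ℕ} {Ω : Type*}

/-- The empirical risk `R_n^D(f_θ)` on the discretized data. -/
noncomputable def empRisk (D : Grid K) (σ : ℝ → ℝ) (loss : ℝ → ℝ → ℝ)
    (y : Fin n → ℝ) (x : Fin n → Fin (K + 1) → Vec d) (θ : Param d p q) : ℝ :=
  (1 / (n : ℝ)) * ∑ i, loss (y i) (θ.predict σ D (x i))

/-- The expected risk `R^D(f_θ)` on the discretized data. -/
noncomputable def risk [MeasurableSpace Ω] (P : Measure Ω) (D : Grid K) (σ : ℝ → ℝ)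
    (loss : ℝ → ℝ → ℝ) (y : Ω → ℝ) (x : Ω → Fin (K + 1) → Vec d) (θ : Param d p q) : ℝ :=
  ∫ ω, loss (y ω) (θ.predict σ D (x ω)) ∂P

/-- A path on the unit interval that is `L`-Lipschitz and starts in the ball of radius `B`. -/
def IsAdmissiblePath (L B : ℝ) (x : ℝ → Vec d) : Prop :=
  (∀ s ∈ Set.Icc (0 : ℝ) 1, ∀ t ∈ Set.Icc (0 : ℝ) 1, ‖x t - x s‖ ≤ L * |t - s|) ∧ ‖x 0‖ ≤ B

end NCDE

namespace NCDE

/-! ### The bounded differences inequality -/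

section BoundedDifferences

variable {E : Type*} [MeasurableSpace E] (ν : Measure E) [IsProbabilityMeasure ν]

/-! The quantity to bound is the deviation of the empirical mean of the loss below its expectation
at `θhat`. It is bounded uniformly over `Θ`, by chaining along finite nets and a bounded differences
inequality, with neither symmetrization nor an entropy integral.

The geometric input is that on admissible series the prediction is Lipschitz in each block of
parameters. Propagating errors through the layers gives `norm_vectorField_sub_le`; a discrete
Grönwall argument along the grid and the linear readout then give `Regular.abs_predict_sub_le`.
Volume bounds for nets of balls, multiplied over the blocks, yield nets of `Θ` at scale `M / 2 ^ k`
for the sup distance of predictions. For `k ≥ 1` their logarithmic size is at most `(k + 2) Λ`,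
where `Λ` is `complexity`. At scale `M` the single parameter `0` suffices, because it predicts `0`.

The probabilistic input is the exponential moment bound for functions with bounded differences. It
makes the difference of two deviations sub-Gaussian with proxy `r² / n` when the two losses are
within `r` of each other. A link of the chain therefore costs `r 2⁻ᵏ / √n · √(2 (k + 3) Λ)` in
expectation, where `r = Lℓ M`, and the links sum to at most `8 r √Λ / √n`. The maximal deviation
over one finite net has bounded differences `Mℓ / n`, which gives the `δ` term. Passing from a fine
enough net to all of `Θ` costs at most `16 r √Λ / √n`, whence the constant `24 = 8 + 16`. Only
finite maxima are integrated, so no supremum over `Θ` has to be measurable.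

These arguments need bounds valid for every parameter and data point, whereas the loss is controlled
only on `Θ` and on admissible data; `truncatedLoss` bridges the gap and agrees with the loss almost
surely on `Θ`. -/

theorem integrable_of_abs_le {α : Type*} [MeasurableSpace α] {μ : Measure α} [IsFiniteMeasure μ]
    {f : α → ℝ} (hf : Measurable f) {C : ℝ} (hC : ∀ x, |f x| ≤ C) : Integrable f μ :=
  Integrable.of_bound hf.aestronglyMeasurable C (.of_forall hC)

/-- Hoeffding's lemma for a bounded function of oscillation at most `c`. -/
theorem integral_exp_le_of_osc {f : E → ℝ} (hf : Measurable f) {c : ℝ} (hc : 0 ≤ c)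
    (hosc : ∀ a b, f a - f b ≤ c) (t : ℝ) :
    ∫ a, Real.exp (t * (f a - ∫ b, f b ∂ν)) ∂ν ≤ Real.exp (c ^ 2 * t ^ 2 / 8) := by
  have : Nonempty E := nonempty_of_isProbabilityMeasure ν
  have hbdd : BddBelow (Set.range f) := by
    obtain ⟨a⟩ := this
    refine ⟨f a - c, ?_⟩
    rintro _ ⟨b, rfl⟩
    linarith [hosc a b]
  -- A function of oscillation at most `c` takes values in the interval of length `c` that starts at
  -- its infimum, which is the form Hoeffding's lemma requires.
  have hI : ∀ a, f a ∈ Set.Icc (⨅ b, f b) ((⨅ b, f b) + c) := fun a => by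
    refine ⟨ciInf_le hbdd a, ?_⟩
    have : f a - c ≤ ⨅ b, f b := le_ciInf fun b => by linarith [hosc a b]
    linarith
  have h := (hasSubgaussianMGF_of_mem_Icc (μ := ν) hf.aemeasurable (.of_forall hI)).mgf_le t
  refine h.trans (le_of_eq ?_)
  congr 1
  simp [abs_of_nonneg hc]
  ring

/-- The moment generating function bound behind McDiarmid's inequality. -/
theorem integral_exp_le_of_boundedDifferences {c : ℝ} (hc : 0 ≤ c) (C t : ℝ) (n : ℕ)
    (f : (Fin n → E) → ℝ) (hf : Measurable f) (hC : ∀ x, |f x| ≤ C)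
    (hdiff : ∀ i x e, |f (Function.update x i e) - f x| ≤ c) :
    ∫ x, Real.exp (t * (f x - ∫ z, f z ∂Measure.pi fun _ => ν)) ∂(Measure.pi fun _ => ν) ≤
      Real.exp (n * (c ^ 2 * t ^ 2 / 8)) := by
  induction n with
  | zero =>
    have : ∀ x, f x = f default := fun x => by rw [Subsingleton.elim x default]
    simp [this]
  | succ n ih =>
    set π : Measure (Fin n → E) := Measure.pi fun _ => ν with hπ
    set f' : E × (Fin n → E) → ℝ := fun z => f (Fin.cons z.1 z.2) with hf'
    have hmp := (measurePreserving_piFinSuccAbove (fun _ : Fin (n + 1) => ν) 0).symm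
    have hsymm : ∀ z, (MeasurableEquiv.piFinSuccAbove (fun _ : Fin (n + 1) => E) 0).symm z =
        Fin.cons z.1 z.2 := fun z => by
      simp [MeasurableEquiv.piFinSuccAbove_symm_apply, Fin.insertNthEquiv]
    have htrans : ∀ F : (Fin (n + 1) → E) → ℝ,
        ∫ x, F x ∂(Measure.pi fun _ => ν) = ∫ z, F (Fin.cons z.1 z.2) ∂(ν.prod π) := fun F => by
      rw [← hmp.integral_comp']
      simp only [hsymm]
      rfl
    have hf'm : Measurable f' := by
      have : f' = f ∘ (MeasurableEquiv.piFinSuccAbove (fun _ : Fin (n + 1) => E) 0).symm := by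
        funext z
        simp only [Function.comp, hsymm, hf']
      rw [this]
      exact hf.comp (MeasurableEquiv.measurable _)
    -- Averaging out the first coordinate leaves a function of `n` coordinates with the same mean
    -- and the same bounded differences, to which the induction hypothesis applies.
    set h : (Fin n → E) → ℝ := fun x => ∫ a, f' (a, x) ∂ν with hh
    have hhm : Measurable h := (hf'm.stronglyMeasurable.integral_prod_left').measurable
    have hint : ∀ x, Integrable (fun a => f' (a, x)) ν := fun x =>
      integrable_of_abs_le (hf'm.comp measurable_prodMk_right) (C := C) fun a => hC _
    have hhC : ∀ x, |h x| ≤ C := fun x => by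
      have := norm_integral_le_of_norm_le_const (μ := ν) (f := fun a => f' (a, x)) (C := C)
        (.of_forall fun a => hC _)
      simpa using this
    have hhd : ∀ i x e, |h (Function.update x i e) - h x| ≤ c := fun i x e => by
      rw [hh]
      simp only
      rw [← integral_sub (hint _) (hint _)]
      have := norm_integral_le_of_norm_le_const (μ := ν)
        (f := fun a => f' (a, Function.update x i e) - f' (a, x)) (C := c)
        (.of_forall fun a => by
          have := hdiff i.succ (Fin.cons a x) e
          rw [← Fin.cons_update] at this
          exact this)
      simpa using this
    have hmean : ∫ z, f z ∂(Measure.pi fun _ => ν) = ∫ x, h x ∂π := by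
      rw [htrans, integral_prod_symm]
      exact integrable_of_abs_le hf'm (C := C) fun a => hC _
    have hexp_int : Integrable (fun z : E × (Fin n → E) =>
        Real.exp (t * (f' z - ∫ x, h x ∂π))) (ν.prod π) := by
      refine integrable_of_abs_le (by fun_prop) (C := Real.exp (|t| * (C + |∫ x, h x ∂π|)))
        fun z => ?_
      rw [abs_of_pos (Real.exp_pos _)]
      refine Real.exp_le_exp.2 ((le_abs_self _).trans ?_)
      rw [abs_mul]
      exact mul_le_mul_of_nonneg_left ((abs_sub _ _).trans (add_le_add_left (hC _) _))
        (abs_nonneg _)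
    have hexp_int' : Integrable (fun x => Real.exp (t * (h x - ∫ x, h x ∂π))) π := by
      refine integrable_of_abs_le (by fun_prop) (C := Real.exp (|t| * (C + |∫ x, h x ∂π|)))
        fun z => ?_
      rw [abs_of_pos (Real.exp_pos _)]
      refine Real.exp_le_exp.2 ((le_abs_self _).trans ?_)
      rw [abs_mul]
      exact mul_le_mul_of_nonneg_left ((abs_sub _ _).trans (add_le_add_left (hhC _) _))
        (abs_nonneg _)
    rw [hmean, htrans]
    change ∫ z, Real.exp (t * (f' z - ∫ x, h x ∂π)) ∂(ν.prod π) ≤ _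
    rw [integral_prod_symm _ hexp_int]
    -- With the other coordinates frozen, Hoeffding's lemma for the first one contributes one factor
    -- `exp (c² t² / 8)`.
    have hinner : ∀ x, ∫ a, Real.exp (t * (f' (a, x) - ∫ x, h x ∂π)) ∂ν ≤
        Real.exp (c ^ 2 * t ^ 2 / 8) * Real.exp (t * (h x - ∫ x, h x ∂π)) := fun x => by
      have hosc : ∀ a b, f' (a, x) - f' (b, x) ≤ c := fun a b => by
        have := hdiff 0 (Fin.cons b x) a
        rw [Fin.update_cons_zero] at this
        exact (abs_le.1 this).2
      have := integral_exp_le_of_osc ν (hf'm.comp measurable_prodMk_right) hc hosc t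
      calc ∫ a, Real.exp (t * (f' (a, x) - ∫ x, h x ∂π)) ∂ν
          = ∫ a, Real.exp (t * (f' (a, x) - h x)) * Real.exp (t * (h x - ∫ x, h x ∂π)) ∂ν := by
            congr 1
            funext a
            rw [← Real.exp_add]
            ring_nf
        _ = (∫ a, Real.exp (t * (f' (a, x) - h x)) ∂ν) *
            Real.exp (t * (h x - ∫ x, h x ∂π)) := integral_mul_const _ _
        _ ≤ _ := mul_le_mul_of_nonneg_right this (Real.exp_pos _).le
    calc ∫ x, ∫ a, Real.exp (t * (f' (a, x) - ∫ x, h x ∂π)) ∂ν ∂π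
        ≤ ∫ x, Real.exp (c ^ 2 * t ^ 2 / 8) * Real.exp (t * (h x - ∫ x, h x ∂π)) ∂π :=
          integral_mono hexp_int.integral_prod_right (hexp_int'.const_mul _) hinner
      _ = Real.exp (c ^ 2 * t ^ 2 / 8) * ∫ x, Real.exp (t * (h x - ∫ x, h x ∂π)) ∂π :=
          integral_const_mul _ _
      _ ≤ Real.exp (c ^ 2 * t ^ 2 / 8) * Real.exp (n * (c ^ 2 * t ^ 2 / 8)) :=
          mul_le_mul_of_nonneg_left (ih h hhm hhC hhd) (Real.exp_pos _).le
      _ = _ := by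
          rw [← Real.exp_add]
          push_cast
          ring_nf

/-- The exponent `n c² t² / 8` is `v t² / 2` with `v = n c² / 4`. -/
theorem hasSubgaussianMGF_of_boundedDifferences {c : ℝ} (hc : 0 ≤ c) {C : ℝ} {n : ℕ}
    {f : (Fin n → E) → ℝ} (hf : Measurable f) (hC : ∀ x, |f x| ≤ C)
    (hdiff : ∀ i x e, |f (Function.update x i e) - f x| ≤ c) :
    HasSubgaussianMGF (fun x => f x - ∫ z, f z ∂Measure.pi fun _ => ν)
      (Real.toNNReal (n * c ^ 2 / 4)) (Measure.pi fun _ => ν) where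
  integrable_exp_mul t := by
    refine integrable_of_abs_le (by fun_prop)
      (C := Real.exp (|t| * (C + |∫ z, f z ∂Measure.pi fun _ => ν|))) fun z => ?_
    rw [abs_of_pos (Real.exp_pos _)]
    refine Real.exp_le_exp.2 ((le_abs_self _).trans ?_)
    rw [abs_mul]
    exact mul_le_mul_of_nonneg_left ((abs_sub _ _).trans (add_le_add_left (hC _) _))
      (abs_nonneg _)
  mgf_le t := by
    refine (integral_exp_le_of_boundedDifferences ν hc C t n f hf hC hdiff).trans (le_of_eq ?_)
    rw [Real.coe_toNNReal _ (by positivity)]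
    ring_nf

/-- McDiarmid's inequality, at confidence level `δ`. -/
theorem measure_boundedDifferences_le {n : ℕ} (hn : 1 ≤ n) {B : ℝ} (hB : 0 ≤ B) {C : ℝ}
    {f : (Fin n → E) → ℝ} (hf : Measurable f) (hC : ∀ x, |f x| ≤ C)
    (hdiff : ∀ i x e, |f (Function.update x i e) - f x| ≤ B / n)
    {δ : ℝ} (hδ0 : 0 < δ) (hδ1 : δ < 1) :
    (Measure.pi fun _ => ν).real {x | B * √(Real.log (1 / δ) / (2 * n)) <
      f x - ∫ z, f z ∂Measure.pi fun _ => ν} ≤ δ := by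
  have hn0 : (0 : ℝ) < n := by exact_mod_cast hn
  have h := hasSubgaussianMGF_of_boundedDifferences ν (by positivity) hf hC hdiff
  have hlog : 0 < Real.log (1 / δ) := Real.log_pos (by rw [lt_div_iff₀ hδ0]; linarith)
  -- For `B = 0` the proxy vanishes and the Chernoff bound degenerates to `1`; the function is then
  -- almost surely equal to its mean, so the event is null.
  rcases hB.eq_or_lt with rfl | hB
  · have h0 : HasSubgaussianMGF (fun x => f x - ∫ z, f z ∂Measure.pi fun _ => ν) 0
      (Measure.pi fun _ => ν) := by simpa using h
    have hae := h0.ae_eq_zero_of_hasSubgaussianMGF_zero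
    have : (Measure.pi fun _ => ν) {x | 0 * √(Real.log (1 / δ) / (2 * n)) <
        f x - ∫ z, f z ∂Measure.pi fun _ => ν} = 0 := by
      refine measure_mono_null ?_ (ae_iff.1 hae)
      intro x hx
      simp only [Set.mem_ofPred_eq, zero_mul] at hx
      exact hx.ne'
    rw [Measure.real, this]
    simpa using hδ0.le
  · have h1 := h.measure_ge_le (ε := B * √(Real.log (1 / δ) / (2 * n))) (by positivity)
    refine (measureReal_mono fun x hx => ?_).trans (h1.trans (le_of_eq ?_))
    · rw [Set.mem_ofPred_eq] at hx ⊢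
      exact hx.le
    · rw [Real.coe_toNNReal _ (by positivity), mul_pow, Real.sq_sqrt (by positivity)]
      have : -(B ^ 2 * (Real.log (1 / δ) / (2 * n))) / (2 * (n * (B / n) ^ 2 / 4)) =
          Real.log δ := by
        rw [one_div, Real.log_inv]
        field_simp
        ring
      rw [this, Real.exp_log hδ0]

end BoundedDifferences

/-! ### The expected maximum of finitely many sub-Gaussian variables -/

/-- The exponential of `t F` is at most the sum of those of `t W s`, whose expectation is at most
`|S| exp (v t² / 2)`. The parameter `t` stays free for later optimization. -/
theorem integral_le_of_le_subgaussian {α ι : Type*} [MeasurableSpace α] {μ : Measure α}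
    [IsProbabilityMeasure μ] {S : Finset ι} (hS : S.Nonempty) {W : ι → α → ℝ} {v : NNReal}
    (hW : ∀ s ∈ S, HasSubgaussianMGF (W s) v μ) {F : α → ℝ} (hF : Integrable F μ)
    (hle : ∀ x, ∃ s ∈ S, F x ≤ W s x) {Λ : ℝ} (hΛ : Real.log S.card ≤ Λ) {t : ℝ} (ht : 0 < t) :
    ∫ x, F x ∂μ ≤ Λ / t + v * t / 2 := by
  have hcard : (0 : ℝ) < S.card := by exact_mod_cast hS.card_pos
  -- The tangent inequality `1 + u ≤ exp u` at `u = t F - a` replaces Jensen's inequality. This `a`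
  -- is the logarithm of the bound on the summed exponential moments, so multiplying by `exp (-a)`
  -- leaves at most `1`.
  set a : ℝ := Real.log S.card + v * t ^ 2 / 2 with ha
  have hpt : ∀ x, t * F x ≤ (∑ s ∈ S, Real.exp (t * W s x)) * Real.exp (-a) + (a - 1) := by
    intro x
    obtain ⟨s, hs, hFs⟩ := hle x
    have h1 : t * F x - a + 1 ≤ Real.exp (t * F x - a) := Real.add_one_le_exp _
    have h2 : Real.exp (t * F x - a) ≤ Real.exp (t * W s x) * Real.exp (-a) := by
      rw [← Real.exp_add]
      exact Real.exp_le_exp.2 (by nlinarith)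
    have h3 : Real.exp (t * W s x) ≤ ∑ s ∈ S, Real.exp (t * W s x) :=
      Finset.single_le_sum (f := fun s => Real.exp (t * W s x))
        (fun _ _ => (Real.exp_pos _).le) hs
    have h4 := mul_le_mul_of_nonneg_right h3 (Real.exp_pos (-a)).le
    linarith
  have hsum : Integrable (fun x => ∑ s ∈ S, Real.exp (t * W s x)) μ :=
    integrable_finsetSum _ fun s hs => (hW s hs).integrable_exp_mul t
  have h1 : ∫ x, t * F x ∂μ ≤
      ∫ x, (∑ s ∈ S, Real.exp (t * W s x)) * Real.exp (-a) + (a - 1) ∂μ :=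
    integral_mono (hF.const_mul t) ((hsum.mul_const _).add (integrable_const _)) hpt
  rw [integral_const_mul, integral_add (hsum.mul_const _) (integrable_const _),
    integral_mul_const, integral_finsetSum _ fun s hs => (hW s hs).integrable_exp_mul t] at h1
  have h2 : ∑ s ∈ S, ∫ x, Real.exp (t * W s x) ∂μ ≤ S.card * Real.exp (v * t ^ 2 / 2) := by
    have := Finset.sum_le_card_nsmul S (fun s => ∫ x, Real.exp (t * W s x) ∂μ)
      (Real.exp (v * t ^ 2 / 2)) fun s hs => (hW s hs).mgf_le t
    simpa using this
  have h3 : S.card * Real.exp (v * t ^ 2 / 2) * Real.exp (-a) = 1 := by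
    rw [ha, neg_add, Real.exp_add, Real.exp_neg (Real.log _), Real.exp_log hcard, Real.exp_neg]
    field_simp
  have h4 := mul_le_mul_of_nonneg_right h2 (Real.exp_pos (-a)).le
  rw [h3] at h4
  simp only [integral_const, probReal_univ, smul_eq_mul, one_mul] at h1
  have h5 : t * ∫ x, F x ∂μ ≤ Λ + v * t ^ 2 / 2 := by linarith
  have h6 : Λ / t + v * t / 2 = (Λ + v * t ^ 2 / 2) / t := by field_simp
  rw [h6, le_div_iff₀ ht]
  linarith

/-- The expected maximum of `exp Λ` variables with variance proxy `σ ^ 2`. -/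
theorem integral_le_mul_sqrt_of_le_subgaussian {α ι : Type*} [MeasurableSpace α] {μ : Measure α}
    [IsProbabilityMeasure μ] {S : Finset ι} (hS : S.Nonempty) {W : ι → α → ℝ} {σ : ℝ}
    (hσ : 0 ≤ σ) (hW : ∀ s ∈ S, HasSubgaussianMGF (W s) (Real.toNNReal (σ ^ 2)) μ) {F : α → ℝ}
    (hF : Integrable F μ) (hle : ∀ x, ∃ s ∈ S, F x ≤ W s x) {Λ : ℝ} (hΛ0 : 0 < Λ)
    (hΛ : Real.log S.card ≤ Λ) :
    ∫ x, F x ∂μ ≤ σ * √(2 * Λ) := by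
  have key := fun t ht => integral_le_of_le_subgaussian hS hW hF hle hΛ (t := t) ht
  rw [Real.coe_toNNReal _ (sq_nonneg σ)] at key
  -- With zero proxy the bound is `Λ / t`, which is made arbitrarily small; otherwise the optimal
  -- `t` is `√(2 Λ) / σ`.
  rcases hσ.eq_or_lt with rfl | hσ
  · rw [zero_mul]
    refine le_of_forall_pos_le_add fun ε hε => ?_
    refine (key (Λ / ε) (by positivity)).trans (le_of_eq ?_)
    field_simp
    ring
  · have hs : 0 < √(2 * Λ) := by positivity
    refine (key (√(2 * Λ) / σ) (by positivity)).trans (le_of_eq ?_)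
    have hsq : √(2 * Λ) ^ 2 = 2 * Λ := Real.sq_sqrt (by positivity)
    generalize √(2 * Λ) = w at hs hsq
    have hΛw : Λ = w ^ 2 / 2 := by linarith
    rw [hΛw]
    field_simp
    ring

/-! ### Nets of balls in finite-dimensional spaces -/

section Nets

variable {E : Type*} [NormedAddCommGroup E] [NormedSpace ℝ E] [FiniteDimensional ℝ E]

/-- Balls of radius `η / 2` around separated points are disjoint and lie in the ball of radius `B +
η / 2`; comparing volumes bounds their number. -/
theorem card_le_of_separated_of_norm_le {B η : ℝ} (hB : 0 ≤ B) (hη : 0 < η) (s : Finset E)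
    (hs : ∀ x ∈ s, ‖x‖ ≤ B) (hsep : ∀ x ∈ s, ∀ y ∈ s, x ≠ y → η ≤ ‖x - y‖) :
    (s.card : ℝ) ≤ (1 + 2 * B / η) ^ Module.finrank ℝ E := by
  borelize E
  let μ : Measure E := Measure.addHaar
  have hη2 : 0 < η / 2 := by positivity
  have hρ : 0 < B + η / 2 := by positivity
  have hdisj : Set.PairwiseDisjoint (s : Set E) (fun c => Metric.ball c (η / 2)) := by
    intro x hx y hy hxy
    refine Metric.ball_disjoint_ball ?_
    rw [dist_eq_norm]
    linarith [hsep x hx y hy hxy]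
  have hsub : (⋃ x ∈ s, Metric.ball x (η / 2)) ⊆ Metric.ball (0 : E) (B + η / 2) := by
    refine Set.iUnion₂_subset fun x hx => Metric.ball_subset_ball' ?_
    rw [dist_zero_right]
    linarith [hs x hx]
  have hvol : (s.card : ENNReal) * ENNReal.ofReal ((η / 2) ^ Module.finrank ℝ E) *
      μ (Metric.ball 0 1) ≤
      ENNReal.ofReal ((B + η / 2) ^ Module.finrank ℝ E) * μ (Metric.ball 0 1) := by
    rw [← μ.addHaar_ball_of_pos 0 hρ]
    refine le_trans (le_of_eq ?_) (measure_mono hsub)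
    rw [measure_biUnion_finset hdisj fun _ _ => measurableSet_ball]
    simp only [μ.addHaar_ball_of_pos _ hη2, Finset.sum_const, nsmul_eq_mul, mul_assoc]
  have hvol' := (ENNReal.mul_le_mul_iff_left
    (Metric.measure_ball_pos μ (0 : E) zero_lt_one).ne' measure_ball_lt_top.ne).1 hvol
  have h := ENNReal.toReal_le_of_le_ofReal (by positivity) hvol'
  rw [ENNReal.toReal_mul, ENNReal.toReal_natCast, ENNReal.toReal_ofReal (by positivity),
    ← le_div_iff₀ (by positivity), ← div_pow] at h
  refine h.trans (le_of_eq ?_)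
  congr 1
  field_simp
  ring

/-- A ball of radius `B` has a net of its own points at scale `e` for the norm scaled by `C`, of
cardinality at most `(1 + 2 B C / e) ^ dim`. -/
theorem exists_finset_net {B C e : ℝ} (hB : 0 ≤ B) (hC : 0 ≤ C) (he : 0 < e) :
    ∃ s : Finset E, s.Nonempty ∧ (∀ x ∈ s, ‖x‖ ≤ B) ∧
      (∀ x : E, ‖x‖ ≤ B → ∃ y ∈ s, C * ‖x - y‖ ≤ e) ∧
      (s.card : ℝ) ≤ (1 + 2 * (B * C) / e) ^ Module.finrank ℝ E := by
  classical
  rcases hC.eq_or_lt with rfl | hC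
  · exact ⟨{0}, by simp, by simpa using hB, fun x _ => ⟨0, by simp, by simpa using he.le⟩,
      by simp⟩
  set η : ℝ := e / C with hη_def
  have hη : 0 < η := by positivity
  -- A separated set of maximal cardinality, which exists by the volume bound, is a net: an
  -- uncovered point could be added to it.
  let Sep : Finset E → Prop := fun s =>
    (∀ x ∈ s, ‖x‖ ≤ B) ∧ ∀ x ∈ s, ∀ y ∈ s, x ≠ y → η ≤ ‖x - y‖
  let T : Set ℕ := {m | ∃ s, Sep s ∧ s.card = m}
  have hT : BddAbove T := by
    refine ⟨⌊(1 + 2 * B / η) ^ Module.finrank ℝ E⌋₊, ?_⟩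
    rintro _ ⟨s, hs, rfl⟩
    exact Nat.le_floor (card_le_of_separated_of_norm_le hB hη s hs.1 hs.2)
  have hT0 : T.Nonempty := ⟨1, {0}, ⟨by simpa using hB, by simp⟩, by simp⟩
  obtain ⟨s, hs, hcard⟩ : sSup T ∈ T := Nat.sSup_mem hT0 hT
  have hcover : ∀ x : E, ‖x‖ ≤ B → ∃ y ∈ s, ‖x - y‖ < η ∨ x = y := by
    intro x hx
    by_contra! hcon
    have hxs : x ∉ s := fun h => (hcon x h).2 rfl
    have hsep : Sep (insert x s) := by
      refine ⟨fun z hz => ?_, fun z hz w hw hzw => ?_⟩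
      · rcases Finset.mem_insert.1 hz with rfl | hz
        exacts [hx, hs.1 z hz]
      · rcases Finset.mem_insert.1 hz with hzx | hzs <;>
          rcases Finset.mem_insert.1 hw with hwx | hws
        · exact absurd (hzx.trans hwx.symm) hzw
        · rw [hzx]
          exact (hcon w hws).1
        · rw [hwx, norm_sub_rev]
          exact (hcon z hzs).1
        · exact hs.2 z hzs w hws hzw
    have := le_csSup hT (show (insert x s).card ∈ T from ⟨_, hsep, rfl⟩)
    rw [Finset.card_insert_of_notMem hxs] at this
    omega
  refine ⟨s, ?_, hs.1, fun x hx => ?_, ?_⟩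
  · obtain ⟨y, hy, -⟩ := hcover 0 (by simpa using hB)
    exact ⟨y, hy⟩
  · obtain ⟨y, hy, h | rfl⟩ := hcover x hx
    · refine ⟨y, hy, ?_⟩
      rw [hη_def, lt_div_iff₀ hC] at h
      linarith
    · exact ⟨x, hy, by simpa using he.le⟩
  · refine (card_le_of_separated_of_norm_le hB hη s hs.1 hs.2).trans (le_of_eq ?_)
    rw [hη_def]
    congr 2
    field_simp

end Nets

/-! ### Chaining -/

section Chaining

theorem sum_update_sub_sum {E : Type*} {n : ℕ} (f : E → ℝ) (x : Fin n → E) (i : Fin n) (e : E) :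
    ∑ j, f (Function.update x i e j) - ∑ j, f (x j) = f e - f (x i) := by
  rw [← Finset.sum_sub_distrib, Finset.sum_eq_single i]
  · simp
  · intro j _ hj
    simp [Function.update_of_ne hj]
  · simp

variable {Θ E : Type*} [MeasurableSpace E]

/-- The deviation of the empirical mean of `g θ` below its expectation. -/
noncomputable def deviation {n : ℕ} (ν : Measure E) (g : Θ → E → ℝ) (θ : Θ) (x : Fin n → E) : ℝ :=
  ∫ e, g θ e ∂ν - (1 / (n : ℝ)) * ∑ i, g θ (x i)

/-- The greatest deviation over a finite set. -/
noncomputable def maxDeviation {n : ℕ} (ν : Measure E) (g : Θ → E → ℝ) (S : Finset Θ)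
    (hS : S.Nonempty) (x : Fin n → E) : ℝ :=
  S.sup' hS fun θ => deviation ν g θ x

variable (ν : Measure E) {g : Θ → E → ℝ}

theorem measurable_deviation {n : ℕ} {θ : Θ} (hg : Measurable (g θ)) :
    Measurable (deviation (n := n) ν g θ) := by
  unfold deviation
  fun_prop

theorem measurable_maxDeviation {n : ℕ} (hg : ∀ θ, Measurable (g θ)) (S : Finset Θ)
    (hS : S.Nonempty) : Measurable (maxDeviation (n := n) ν g S hS) := by
  have := Finset.measurable_sup' hS fun θ _ => measurable_deviation (n := n) ν (hg θ)
  convert this using 1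
  funext x
  rw [maxDeviation, Finset.sup'_apply]

theorem deviation_sub {n : ℕ} {θ θ' : Θ} (h : Integrable (g θ) ν) (h' : Integrable (g θ') ν)
    (x : Fin n → E) :
    deviation ν g θ x - deviation ν g θ' x =
      ∫ e, (g θ e - g θ' e) ∂ν - (1 / (n : ℝ)) * ∑ i, (g θ (x i) - g θ' (x i)) := by
  rw [integral_sub h h', Finset.sum_sub_distrib, deviation, deviation]
  ring

/-- Two values in `[0, B]` differ by at most `B`; nonnegativity thus gives `B / n` where a bound on
`|g θ|` alone would give `2 B / n`. -/
theorem abs_deviation_update_sub_le {n : ℕ} {B : ℝ} {θ : Θ}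
    (hg0 : ∀ e, 0 ≤ g θ e) (hgB : ∀ e, g θ e ≤ B) (i : Fin n) (x : Fin n → E) (e : E) :
    |deviation ν g θ (Function.update x i e) - deviation ν g θ x| ≤ B / n := by
  have h : deviation ν g θ (Function.update x i e) - deviation ν g θ x =
      -((1 / (n : ℝ)) * (g θ e - g θ (x i))) := by
    rw [← sum_update_sub_sum (g θ) x i e, deviation, deviation]
    ring
  rw [h, abs_neg, abs_mul, abs_of_nonneg (by positivity : (0 : ℝ) ≤ 1 / n), one_div,
    inv_mul_eq_div]
  refine div_le_div_of_nonneg_right ?_ (by positivity)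
  rw [abs_le]
  constructor <;> linarith [hg0 e, hgB e, hg0 (x i), hgB (x i)]

theorem abs_maxDeviation_update_sub_le {n : ℕ} {B : ℝ} (hg0 : ∀ θ e, 0 ≤ g θ e) (hgB : ∀ θ e, g θ e ≤ B)
    (S : Finset Θ) (hS : S.Nonempty) (i : Fin n) (x : Fin n → E) (e : E) :
    |maxDeviation ν g S hS (Function.update x i e) - maxDeviation ν g S hS x| ≤ B / n := by
  have key := fun θ => abs_le.1 (abs_deviation_update_sub_le ν (hg0 θ) (hgB θ) i x e)
  rw [abs_le, neg_le_sub_iff_le_add, sub_le_iff_le_add]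
  constructor
  · refine Finset.sup'_le _ _ fun θ hθ => ?_
    have := Finset.le_sup' (fun θ => deviation ν g θ (Function.update x i e)) hθ
    have h2 := (key θ).1
    unfold maxDeviation
    linarith
  · refine Finset.sup'_le _ _ fun θ hθ => ?_
    have := Finset.le_sup' (fun θ => deviation ν g θ x) hθ
    have h2 := (key θ).2
    unfold maxDeviation
    linarith

theorem abs_mean_le {n : ℕ} (hn : 1 ≤ n) {f : Fin n → ℝ} {r : ℝ} (hf : ∀ i, |f i| ≤ r) :
    |(1 / (n : ℝ)) * ∑ i, f i| ≤ r := by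
  have hn0 : (0 : ℝ) < n := by exact_mod_cast hn
  rw [abs_mul, abs_of_pos (by positivity : (0 : ℝ) < 1 / n), one_div, inv_mul_le_iff₀ hn0]
  refine (Finset.abs_sum_le_sum_abs _ _).trans ?_
  simpa using Finset.sum_le_card_nsmul Finset.univ _ r fun i _ => hf i

variable [IsProbabilityMeasure ν]

theorem abs_integral_le_of_abs_le {f : E → ℝ} {r : ℝ} (hf : ∀ e, |f e| ≤ r) :
    |∫ e, f e ∂ν| ≤ r := by
  simpa using norm_integral_le_of_norm_le_const (μ := ν) (f := f) (C := r) (.of_forall hf)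

theorem abs_deviation_sub_le {n : ℕ} (hn : 1 ≤ n) {θ θ' : Θ} (h : Integrable (g θ) ν)
    (h' : Integrable (g θ') ν) {r : ℝ} (hr : ∀ e, |g θ e - g θ' e| ≤ r) (x : Fin n → E) :
    |deviation ν g θ x - deviation ν g θ' x| ≤ 2 * r := by
  rw [deviation_sub ν h h']
  have h1 := abs_integral_le_of_abs_le ν hr
  have h2 := abs_mean_le hn fun i => hr (x i)
  exact (abs_sub _ _).trans (by linarith)

theorem abs_deviation_le {n : ℕ} (hn : 1 ≤ n) {B : ℝ} {θ : Θ} (hg : ∀ e, |g θ e| ≤ B)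
    (x : Fin n → E) : |deviation ν g θ x| ≤ 2 * B := by
  have h1 := abs_integral_le_of_abs_le ν hg
  have h2 := abs_mean_le hn fun i => hg (x i)
  exact (abs_sub _ _).trans (by linarith)

theorem integral_deviation {n : ℕ} (hn : 1 ≤ n) {θ : Θ} (hg : Integrable (g θ) ν) :
    ∫ x, deviation (n := n) ν g θ x ∂(Measure.pi fun _ => ν) = 0 := by
  have hn0 : (0 : ℝ) < n := by exact_mod_cast hn
  have hi : ∀ i : Fin n, Integrable (fun x : Fin n → E => g θ (x i)) (Measure.pi fun _ => ν) :=
    fun i => (measurePreserving_eval (fun _ : Fin n => ν) i).integrable_comp_of_integrable hg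
  have he : ∀ i : Fin n, ∫ x : Fin n → E, g θ (x i) ∂(Measure.pi fun _ => ν) = ∫ e, g θ e ∂ν :=
    fun i => by
      have hmp := measurePreserving_eval (fun _ : Fin n => ν) i
      have := integral_map (μ := Measure.pi fun _ : Fin n => ν) hmp.measurable.aemeasurable
        (f := g θ) (by rw [hmp.map_eq]; exact hg.aestronglyMeasurable)
      rw [hmp.map_eq] at this
      exact this.symm
  unfold deviation
  rw [integral_sub (integrable_const _) ((integrable_finsetSum _ fun i _ => hi i).const_mul _),
    integral_const_mul, integral_finsetSum _ fun i _ => hi i]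
  simp only [he, integral_const, probReal_univ, smul_eq_mul, one_mul, Finset.sum_const,
    Finset.card_univ, Fintype.card_fin, nsmul_eq_mul]
  field_simp
  ring

/-- The difference is centred, and replacing one sample point moves it by at most `2 r / n`, so its
proxy is `n (2 r / n)² / 4 = r² / n`. -/
theorem hasSubgaussianMGF_deviation_sub {n : ℕ} (hn : 1 ≤ n) {θ θ' : Θ} (h : Measurable (g θ))
    (h' : Measurable (g θ')) (hi : Integrable (g θ) ν) (hi' : Integrable (g θ') ν) {r : ℝ}
    (hr : ∀ e, |g θ e - g θ' e| ≤ r) (hr0 : 0 ≤ r) :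
    HasSubgaussianMGF (fun x : Fin n → E => deviation ν g θ x - deviation ν g θ' x)
      (Real.toNNReal ((r / √n) ^ 2)) (Measure.pi fun _ => ν) := by
  have hn0 : (0 : ℝ) < n := by exact_mod_cast hn
  have hint : ∀ {θ}, Measurable (g θ) → Integrable (g θ) ν → Integrable
      (fun x : Fin n → E => deviation ν g θ x) (Measure.pi fun _ => ν) := fun {θ} hm hi => by
    unfold deviation
    exact (integrable_const _).sub ((integrable_finsetSum _ fun i _ =>
      (measurePreserving_eval (fun _ : Fin n => ν) i).integrable_comp_of_integrable hi).const_mul _)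
  have key := hasSubgaussianMGF_of_boundedDifferences ν (c := 2 * r / n) (by positivity)
    (f := fun x : Fin n → E => deviation ν g θ x - deviation ν g θ' x) (C := 2 * r)
    ((measurable_deviation ν h).sub (measurable_deviation ν h'))
    (abs_deviation_sub_le ν hn hi hi' hr) (fun i x e => by
      have h : deviation ν g θ (Function.update x i e) - deviation ν g θ' (Function.update x i e) -
          (deviation ν g θ x - deviation ν g θ' x) =
          -((1 / (n : ℝ)) * ((g θ e - g θ' e) - (g θ (x i) - g θ' (x i)))) := by
        rw [← sum_update_sub_sum (fun e => g θ e - g θ' e) x i e, deviation_sub ν hi hi',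
          deviation_sub ν hi hi']
        ring
      rw [h, abs_neg, abs_mul, abs_of_nonneg (by positivity : (0 : ℝ) ≤ 1 / n), one_div,
        inv_mul_eq_div]
      refine div_le_div_of_nonneg_right ?_ (by positivity)
      exact (abs_sub _ _).trans (by linarith [hr e, hr (x i)]))
  rw [integral_sub (hint h hi) (hint h' hi'), integral_deviation ν hn hi,
    integral_deviation ν hn hi'] at key
  simp only [sub_zero] at key
  convert key using 2
  rw [div_pow, Real.sq_sqrt hn0.le]
  field_simp
  ring

variable {B : ℝ}

theorem abs_maxDeviation_le {n : ℕ} (hn : 1 ≤ n) (hg : ∀ θ e, |g θ e| ≤ B) (S : Finset Θ)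
    (hS : S.Nonempty) (x : Fin n → E) : |maxDeviation ν g S hS x| ≤ 2 * B := by
  obtain ⟨θ, -, hθ⟩ := S.exists_mem_eq_sup' hS fun θ => deviation ν g θ x
  rw [maxDeviation, hθ]
  exact abs_deviation_le ν hn (hg θ) x

/-- One link of the chain. -/
theorem integral_maxDeviation_le_add {n : ℕ} (hn : 1 ≤ n) (hgm : ∀ θ, Measurable (g θ))
    (hg : ∀ θ e, |g θ e| ≤ B) {S S' : Finset Θ} (hS : S.Nonempty) (hS' : S'.Nonempty) {r : ℝ}
    (hr : 0 ≤ r) (hnet : ∀ θ ∈ S', ∃ s ∈ S, ∀ e, |g θ e - g s e| ≤ r) {Λ : ℝ} (hΛ0 : 0 < Λ)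
    (hΛ : Real.log S'.card ≤ Λ) :
    ∫ x, maxDeviation (n := n) ν g S' hS' x ∂(Measure.pi fun _ => ν) ≤
      ∫ x, maxDeviation (n := n) ν g S hS x ∂(Measure.pi fun _ => ν) + r / √n * √(2 * Λ) := by
  classical
  have hint : ∀ {S} (hS : S.Nonempty), Integrable (maxDeviation (n := n) ν g S hS)
      (Measure.pi fun _ => ν) := fun {S} hS =>
    integrable_of_abs_le (measurable_maxDeviation ν hgm S hS) (abs_maxDeviation_le ν hn hg S hS)
  have hgi : ∀ θ, Integrable (g θ) ν := fun θ => integrable_of_abs_le (hgm θ) (hg θ)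
  -- If `θ` attains the maximum over `S'`, the increase from the maximum over `S` is at most the
  -- deviation at `θ` minus that at its neighbour `π θ`: one of `|S'|` sub-Gaussian variables.
  choose! π hπS hπ using hnet
  have := integral_le_mul_sqrt_of_le_subgaussian hS' (σ := r / √n) (by positivity)
    (W := fun θ (x : Fin n → E) => deviation ν g θ x - deviation ν g (π θ) x)
    (fun θ hθ => hasSubgaussianMGF_deviation_sub ν hn (hgm _) (hgm _) (hgi _) (hgi _)
      (hπ θ hθ) hr)
    ((hint hS').sub (hint hS)) (fun x => by
      obtain ⟨θ, hθS, hθ⟩ := S'.exists_mem_eq_sup' hS' fun θ => deviation ν g θ x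
      refine ⟨θ, hθS, ?_⟩
      have h1 : maxDeviation ν g S' hS' x = deviation ν g θ x := hθ
      have h2 : deviation ν g (π θ) x ≤ maxDeviation ν g S hS x :=
        Finset.le_sup' (fun θ => deviation ν g θ x) (hπS θ hθS)
      simp only [Pi.sub_apply, h1]
      linarith) hΛ0 hΛ
  simp only [Pi.sub_apply] at this
  rw [integral_sub (hint hS') (hint hS)] at this
  linarith

/-- The chaining bound along nets of dyadic scales whose logarithmic sizes grow linearly. -/
theorem integral_maxDeviation_le {n : ℕ} (hn : 1 ≤ n) (hgm : ∀ θ, Measurable (g θ))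
    (hg : ∀ θ e, |g θ e| ≤ B) {T : Set Θ} {S : ℕ → Finset Θ} (hS : ∀ k, (S k).Nonempty)
    (hST : ∀ k, ↑(S k) ⊆ T) {θ₀ : Θ} (hS0 : S 0 = {θ₀}) {r : ℝ} (hr : 0 ≤ r)
    (hnet : ∀ k, ∀ θ ∈ T, ∃ s ∈ S k, ∀ e, |g θ e - g s e| ≤ r / 2 ^ k) {Λ : ℝ} (hΛ0 : 0 < Λ)
    (hΛ : ∀ k, Real.log (S (k + 1)).card ≤ (k + 3) * Λ) (k : ℕ) :
    ∫ x, maxDeviation (n := n) ν g (S k) (hS k) x ∂(Measure.pi fun _ => ν) ≤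
      r / √n * √Λ * (8 - 2 * (k + 4) / 2 ^ k) := by
  induction k with
  | zero =>
    have : ∀ x : Fin n → E, maxDeviation ν g (S 0) (hS 0) x = deviation ν g θ₀ x := fun x => by
      simp only [maxDeviation, hS0, Finset.sup'_singleton]
    simp only [this, integral_deviation ν hn (integrable_of_abs_le (hgm θ₀) (hg θ₀))]
    norm_num
  | succ k ih =>
    have h := integral_maxDeviation_le_add ν hn hgm hg (hS k) (hS (k + 1))
      (r := r / 2 ^ k) (by positivity) (fun θ hθ => hnet k θ (hST _ hθ)) (by positivity) (hΛ k)
    -- Since `2 (k + 3) ≤ (k + 3)²`, the links cost at most `(k + 3) / 2 ^ k` up to a common factor,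
    -- and the partial sums of this series have the closed form in the statement.
    have hsqrt : √(2 * ((k + 3) * Λ)) ≤ (k + 3) * √Λ := by
      rw [← mul_assoc, Real.sqrt_mul (by positivity)]
      refine mul_le_mul_of_nonneg_right ?_ (Real.sqrt_nonneg _)
      rw [Real.sqrt_le_left (by positivity)]
      nlinarith [(Nat.cast_nonneg k : (0 : ℝ) ≤ k)]
    have h2 := mul_le_mul_of_nonneg_left hsqrt (by positivity : 0 ≤ r / 2 ^ k / √n)
    refine (h.trans (add_le_add ih h2)).trans (le_of_eq ?_)
    push_cast
    field_simp
    ring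

/-- With high probability, all deviations are controlled by the chaining bound and the bounded
differences term. -/
theorem exists_measurableSet_deviation_le {n : ℕ} (hn : 1 ≤ n) (hgm : ∀ θ, Measurable (g θ))
    (hg0 : ∀ θ e, 0 ≤ g θ e) (hgB : ∀ θ e, g θ e ≤ B) {T : Set Θ} {S : ℕ → Finset Θ}
    (hS : ∀ k, (S k).Nonempty) (hST : ∀ k, ↑(S k) ⊆ T) {θ₀ : Θ} (hS0 : S 0 = {θ₀}) {r : ℝ}
    (hr : 0 ≤ r) (hnet : ∀ k, ∀ θ ∈ T, ∃ s ∈ S k, ∀ e, |g θ e - g s e| ≤ r / 2 ^ k) {Λ : ℝ}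
    (hΛ0 : 0 < Λ) (hΛ : ∀ k, Real.log (S (k + 1)).card ≤ (k + 3) * Λ) {δ : ℝ} (hδ0 : 0 < δ)
    (hδ1 : δ < 1) :
    ∃ A : Set (Fin n → E), MeasurableSet A ∧
      ENNReal.ofReal (1 - δ) ≤ (Measure.pi fun _ => ν) A ∧
      ∀ x ∈ A, ∀ θ ∈ T, deviation ν g θ x ≤
        24 * r / √n * √Λ + B * √(Real.log (1 / δ) / (2 * n)) := by
  have hn0 : (0 : ℝ) < n := by exact_mod_cast hn
  have hB : 0 ≤ B := by
    obtain ⟨e⟩ := nonempty_of_isProbabilityMeasure ν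
    exact (hg0 θ₀ e).trans (hgB θ₀ e)
  have hg : ∀ θ e, |g θ e| ≤ B := fun θ e => abs_le.2 ⟨by linarith [hg0 θ e], hgB θ e⟩
  have hgi : ∀ θ, Integrable (g θ) ν := fun θ => integrable_of_abs_le (hgm θ) (hg θ)
  -- The chain stops once moving from any parameter in `T` to the net costs at most `16 r √Λ / √n`.
  obtain ⟨k, hk⟩ : ∃ k : ℕ, 2 * (1 / 2 : ℝ) ^ k < 16 * (√Λ / √n) := by
    obtain ⟨k, hk⟩ := exists_pow_lt_of_lt_one (y := (1 / 2 : ℝ))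
      (by positivity : 0 < 8 * (√Λ / √n)) (by norm_num)
    exact ⟨k, by linarith⟩
  have hFm := measurable_maxDeviation (n := n) ν hgm (S k) (hS k)
  set m := ∫ x, maxDeviation (n := n) ν g (S k) (hS k) x ∂(Measure.pi fun _ => ν) with hm
  have hmean : m ≤ 8 * (r / √n * √Λ) := by
    refine (integral_maxDeviation_le ν hn hgm hg hS hST hS0 hr hnet hΛ0 hΛ k).trans ?_
    have : 0 ≤ r / √n * √Λ * (2 * (k + 4) / 2 ^ k) := by positivity
    linarith
  have hbad := measure_boundedDifferences_le ν hn hB hFm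
    (abs_maxDeviation_le ν hn hg (S k) (hS k))
    (abs_maxDeviation_update_sub_le ν hg0 hgB (S k) (hS k)) hδ0 hδ1
  set A : Set (Fin n → E) := {x | B * √(Real.log (1 / δ) / (2 * n)) <
    maxDeviation ν g (S k) (hS k) x - m} with hA
  have hAm : MeasurableSet A := measurableSet_lt measurable_const (hFm.sub_const _)
  refine ⟨Aᶜ, hAm.compl, ?_, fun x hx θ hθ => ?_⟩
  · rw [← ofReal_measureReal]
    refine ENNReal.ofReal_le_ofReal ?_
    rw [probReal_compl_eq_one_sub hAm]
    linarith
  · have h1 : maxDeviation ν g (S k) (hS k) x - m ≤ B * √(Real.log (1 / δ) / (2 * n)) :=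
      not_lt.1 fun h => hx h
    obtain ⟨s, hs, hsθ⟩ := hnet k θ hθ
    have h2 := (abs_le.1 (abs_deviation_sub_le ν hn (hgi θ) (hgi s) hsθ x)).2
    have h3 : deviation ν g s x ≤ maxDeviation ν g (S k) (hS k) x :=
      Finset.le_sup' (fun θ => deviation ν g θ x) hs
    have h4 : 2 * (r / 2 ^ k) ≤ 16 * (r / √n * √Λ) := by
      have := mul_le_mul_of_nonneg_left hk.le hr
      calc 2 * (r / 2 ^ k) = r * (2 * (1 / 2) ^ k) := by
            rw [div_pow, one_pow]
            ring
        _ ≤ _ := this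
        _ = _ := by ring
    have h5 : 24 * r / √n * √Λ = 24 * (r / √n * √Λ) := by ring
    rw [h5]
    linarith

end Chaining

/-! ### One layer of a network -/

section Layer

open scoped Matrix.Norms.Frobenius

variable {ι κ : Type*} [Fintype κ]

/-- The layer `z ↦ σ(A z + b)`. -/
noncomputable def layer (σ : ℝ → ℝ) (A : Matrix ι κ ℝ) (b : EuclideanSpace ℝ ι)
    (z : EuclideanSpace ℝ κ) : EuclideanSpace ℝ ι :=
  WithLp.toLp 2 fun i => σ (A.mulVec z.ofLp i + b i)

theorem continuous_layer {σ : ℝ → ℝ} (hσ : Continuous σ) (A : Matrix ι κ ℝ) (b : EuclideanSpace ℝ ι) :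
    Continuous (layer σ A b) := by
  unfold layer
  refine (PiLp.continuous_toLp 2 _).comp (continuous_pi fun i => hσ.comp ?_)
  exact ((continuous_apply i).comp (continuous_const.matrix_mulVec
    (PiLp.continuous_ofLp 2 _))).add continuous_const

variable [Fintype ι]

/-- This lets the matrix-valued last layer be handled as an ordinary layer with output index `ι ×
κ`. -/
theorem frobenius_norm_eq_norm_uncurry (A : Matrix ι κ ℝ) :
    ‖A‖ = ‖WithLp.toLp 2 fun e : ι × κ => A e.1 e.2‖ := by
  rw [Matrix.frobenius_norm_def, EuclideanSpace.norm_eq, Real.sqrt_eq_rpow,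
    Fintype.sum_prod_type]
  simp

theorem norm_mulVec_le (A : Matrix ι κ ℝ) (u : EuclideanSpace ℝ κ) :
    ‖WithLp.toLp 2 (A.mulVec u.ofLp)‖ ≤ ‖A‖ * ‖u‖ := by
  have h := Matrix.frobenius_norm_mul A (Matrix.replicateCol Unit u.ofLp)
  rwa [← Matrix.replicateCol_mulVec, Matrix.frobenius_norm_replicateCol,
    Matrix.frobenius_norm_replicateCol] at h

variable {σ : ℝ → ℝ} {L : ℝ}

theorem norm_comp_sub_comp_le (hL : 0 ≤ L) (hσ : ∀ u w, |σ u - σ w| ≤ L * |u - w|)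
    (v w : EuclideanSpace ℝ ι) :
    ‖WithLp.toLp 2 (fun i => σ (v i)) - WithLp.toLp 2 (fun i => σ (w i))‖ ≤ L * ‖v - w‖ := by
  rw [EuclideanSpace.norm_eq, EuclideanSpace.norm_eq, ← Real.sqrt_sq hL,
    ← Real.sqrt_mul (sq_nonneg L), Finset.mul_sum]
  refine Real.sqrt_le_sqrt (Finset.sum_le_sum fun i _ => ?_)
  rw [← mul_pow]
  exact pow_le_pow_left₀ (norm_nonneg _) (hσ _ _) 2

/-- From `A z - A' z' = (A - A') z + A' (z - z')`. Only `z` enters through its norm, so `z'` needs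
no bound of its own. -/
theorem norm_layer_sub_layer_le (hL : 0 ≤ L) (hσ : ∀ u w, |σ u - σ w| ≤ L * |u - w|)
    (A A' : Matrix ι κ ℝ) (b b' : EuclideanSpace ℝ ι) (z z' : EuclideanSpace ℝ κ) :
    ‖layer σ A b z - layer σ A' b' z'‖ ≤
      L * (‖A - A'‖ * ‖z‖ + ‖A'‖ * ‖z - z'‖ + ‖b - b'‖) := by
  have h := norm_comp_sub_comp_le hL hσ (WithLp.toLp 2 (A.mulVec z.ofLp) + b)
    (WithLp.toLp 2 (A'.mulVec z'.ofLp) + b')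
  refine h.trans (mul_le_mul_of_nonneg_left ?_ hL)
  have e : WithLp.toLp 2 (A.mulVec z.ofLp) + b - (WithLp.toLp 2 (A'.mulVec z'.ofLp) + b') =
      WithLp.toLp 2 ((A - A').mulVec z.ofLp) + WithLp.toLp 2 (A'.mulVec (z - z').ofLp) +
        (b - b') := by
    rw [Matrix.sub_mulVec, WithLp.ofLp_sub, Matrix.mulVec_sub, WithLp.toLp_sub, WithLp.toLp_sub]
    abel
  rw [e]
  exact norm_add₃_le.trans (by gcongr <;> exact norm_mulVec_le _ _)

/-- Comparison with the zero layer, whose output is `0` because `σ 0 = 0`. -/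
theorem norm_layer_le (hL : 0 ≤ L) (hσ : ∀ u w, |σ u - σ w| ≤ L * |u - w|) (hσ0 : σ 0 = 0)
    (A : Matrix ι κ ℝ) (b : EuclideanSpace ℝ ι) (z : EuclideanSpace ℝ κ) :
    ‖layer σ A b z‖ ≤ L * (‖A‖ * ‖z‖ + ‖b‖) := by
  have h := norm_layer_sub_layer_le hL hσ A 0 b 0 z z
  have h0 : layer σ (0 : Matrix ι κ ℝ) 0 z = 0 := by
    ext i
    simp [layer, hσ0]
  simpa [h0] using h

end Layer

/-! ### Bounds on the vector field -/

section VectorField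

open scoped Matrix.Norms.Frobenius

variable {d p q : ℕ} {σ : ℝ → ℝ} {c : Consts}

theorem Param.hidden_zero (θ : Param d p q) (z : Vec p) : θ.hidden σ z 0 = z := rfl

theorem Param.hidden_succ (θ : Param d p q) (z : Vec p) (h : Fin (q - 1)) :
    θ.hidden σ z h.succ = layer σ (θ.A h) (θ.b h) (θ.hidden σ z h.castSucc) := rfl

theorem Param.init_eq_layer (θ : Param d p q) (u : Vec d) :
    θ.init σ u = layer σ θ.U θ.v u := rfl

theorem Param.toLp_vectorField (θ : Param d p q) (z : Vec p) :
    (WithLp.toLp 2 fun e : Fin p × Fin d => θ.vectorField σ z e.1 e.2) =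
      layer σ θ.Alast (WithLp.toLp 2 fun e : Fin p × Fin d => θ.blast e.1 e.2)
        (θ.hidden σ z (Fin.last _)) := rfl

theorem Consts.α_nonneg (hLσ : 0 ≤ c.Lσ) (hBA : 0 ≤ c.BA) (h : ℕ) : 0 ≤ c.α h := by
  unfold Consts.α
  positivity

theorem Consts.β_nonneg (hLσ : 0 ≤ c.Lσ) (hBA : 0 ≤ c.BA) (hBb : 0 ≤ c.Bb) (h : ℕ) :
    0 ≤ c.β h := by
  unfold Consts.β
  exact mul_nonneg (mul_nonneg hLσ hBb)
    (Finset.sum_nonneg fun j _ => pow_nonneg (mul_nonneg hLσ hBA) j)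

theorem Consts.α_succ (h : ℕ) : c.α (h + 1) = c.Lσ * c.BA * c.α h := pow_succ' _ _

theorem Consts.β_succ (h : ℕ) : c.β (h + 1) = c.Lσ * (c.BA * c.β h + c.Bb) := by
  unfold Consts.β
  rw [geom_sum_succ]
  ring

theorem norm_hidden_le (hLσ : 0 ≤ c.Lσ) (hBA : 0 ≤ c.BA)
    (hσ : ∀ u w, |σ u - σ w| ≤ c.Lσ * |u - w|) (hσ0 : σ 0 = 0) {θ : Param d p q}
    (hθ : θ ∈ c.paramSpace d p q) (z : Vec p) (h : Fin (q - 1 + 1)) :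
    ‖θ.hidden σ z h‖ ≤ c.α h * ‖z‖ + c.β h := by
  induction h using Fin.induction with
  | zero => simp [Param.hidden_zero, Consts.α, Consts.β]
  | succ h ih =>
    rw [Param.hidden_succ, Fin.val_succ, Consts.α_succ, Consts.β_succ]
    have h1 := norm_layer_le hLσ hσ hσ0 (θ.A h) (θ.b h) (θ.hidden σ z h.castSucc)
    have h2 : ‖θ.A h‖ * ‖θ.hidden σ z h.castSucc‖ ≤ c.BA * (c.α h * ‖z‖ + c.β h) :=
      mul_le_mul (hθ.2.1 h) ih (norm_nonneg _) hBA
    have h3 := hθ.2.2.1 h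
    calc _ ≤ _ := h1
      _ ≤ c.Lσ * (c.BA * (c.α h * ‖z‖ + c.β h) + c.Bb) := by gcongr
      _ = _ := by ring

theorem norm_vectorField_le (hq : 1 ≤ q) (hLσ : 0 ≤ c.Lσ) (hBA : 0 ≤ c.BA)
    (hσ : ∀ u w, |σ u - σ w| ≤ c.Lσ * |u - w|) (hσ0 : σ 0 = 0) {θ : Param d p q}
    (hθ : θ ∈ c.paramSpace d p q) (z : Vec p) :
    ‖θ.vectorField σ z‖ ≤ c.α q * ‖z‖ + c.β q := by
  obtain ⟨m, rfl⟩ : ∃ m, q = m + 1 := ⟨q - 1, by omega⟩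
  rw [frobenius_norm_eq_norm_uncurry, Param.toLp_vectorField, Consts.α_succ, Consts.β_succ]
  refine (norm_layer_le hLσ hσ hσ0 _ _ _).trans ?_
  rw [← frobenius_norm_eq_norm_uncurry]
  have h2 : ‖θ.Alast‖ * ‖θ.hidden σ z (Fin.last _)‖ ≤ c.BA * (c.α m * ‖z‖ + c.β m) :=
    mul_le_mul hθ.2.2.2.1 (norm_hidden_le hLσ hBA hσ hσ0 hθ z _) (norm_nonneg _) hBA
  have h3 := hθ.2.2.2.2.1
  calc _ ≤ c.Lσ * (c.BA * (c.α m * ‖z‖ + c.β m) + c.Bb) := by gcongr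
    _ = _ := by ring

/-- The total distance between the weights of two vector fields. -/
noncomputable def weightDist (θ θ' : Param d p q) : ℝ :=
  (∑ h, ‖θ.A h - θ'.A h‖) + ‖θ.Alast - θ'.Alast‖

/-- The total distance between the biases of two vector fields. -/
noncomputable def biasDist (θ θ' : Param d p q) : ℝ :=
  (∑ h, ‖θ.b h - θ'.b h‖) + ‖θ.blast - θ'.blast‖

theorem sum_filter_castSucc_lt_succ {m : ℕ} (f : Fin m → ℝ) (k : Fin m) :
    ∑ j with j.castSucc < k.succ, f j = (∑ j with j.castSucc < k.castSucc, f j) + f k := by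
  have : (Finset.univ.filter fun j : Fin m => j.castSucc < k.succ) =
      insert k (Finset.univ.filter fun j : Fin m => j.castSucc < k.castSucc) := by
    ext j
    simp only [Finset.mem_filter, Finset.mem_univ, true_and, Finset.mem_insert, Fin.lt_def,
      Fin.val_castSucc, Fin.val_succ, Fin.ext_iff]
    omega
  rw [this, Finset.sum_insert (by simp), add_comm]

/-- The weight `α (q - h)` anticipates the amplification by the layers still to come. With it each
layer merely adds its own parameter error, with a coefficient bounded by the suprema in `CA` and
`Cb`. -/
theorem norm_hidden_sub_hidden_le (hLσ : 0 ≤ c.Lσ) (hBA : 0 ≤ c.BA)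
    (hσ : ∀ u w, |σ u - σ w| ≤ c.Lσ * |u - w|) (hσ0 : σ 0 = 0) {θ θ' : Param d p q}
    (hθ : θ ∈ c.paramSpace d p q) (hθ' : θ' ∈ c.paramSpace d p q) {R : ℝ} {z : Vec p}
    (hz : ‖z‖ ≤ R) (z' : Vec p) (h : Fin (q - 1 + 1)) :
    c.α (q - h) * ‖θ.hidden σ z h - θ'.hidden σ z' h‖ ≤ c.α q * ‖z - z'‖ +
      (⨆ j : Fin q, c.α (q - 1 - j) * c.Lσ * (c.α j * R + c.β j)) *
        (∑ j with j.castSucc < h, ‖θ.A j - θ'.A j‖) +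
      (⨆ j : Fin q, c.α (q - 1 - j) * c.Lσ) * (∑ j with j.castSucc < h, ‖θ.b j - θ'.b j‖) := by
  induction h using Fin.induction with
  | zero => simp [Param.hidden_zero]
  | succ k ih =>
    rw [sum_filter_castSucc_lt_succ, sum_filter_castSucc_lt_succ, Param.hidden_succ,
      Param.hidden_succ]
    set SA := ⨆ j : Fin q, c.α (q - 1 - j) * c.Lσ * (c.α j * R + c.β j) with hSA
    set Sb := ⨆ j : Fin q, c.α (q - 1 - j) * c.Lσ with hSb
    have hk : (k : ℕ) < q := by omega
    have h1 : c.α (q - 1 - k) * c.Lσ * (c.α k * R + c.β k) ≤ SA :=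
      le_ciSup (f := fun j : Fin q => c.α (q - 1 - j) * c.Lσ * (c.α j * R + c.β j))
        (Set.finite_range _).bddAbove ⟨k, hk⟩
    have h2 : c.α (q - 1 - k) * c.Lσ ≤ Sb :=
      le_ciSup (f := fun j : Fin q => c.α (q - 1 - j) * c.Lσ)
        (Set.finite_range _).bddAbove ⟨k, hk⟩
    have hαk : c.α (q - k) = c.Lσ * c.BA * c.α (q - 1 - k) := by
      rw [← Consts.α_succ]
      congr 1
      omega
    have hαs : c.α (q - k.succ) = c.α (q - 1 - k) := by
      congr 1
      rw [Fin.val_succ]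
      omega
    rw [Fin.val_castSucc, hαk] at ih
    rw [hαs]
    set a := c.α (q - 1 - k) with ha
    have ha0 : 0 ≤ a := Consts.α_nonneg hLσ hBA _
    set u := θ.hidden σ z k.castSucc with hu
    set u' := θ'.hidden σ z' k.castSucc with hu'
    have hun : ‖u‖ ≤ c.α k * R + c.β k := by
      refine (norm_hidden_le hLσ hBA hσ hσ0 hθ z _).trans ?_
      rw [Fin.val_castSucc]
      gcongr
      exact Consts.α_nonneg hLσ hBA _
    have h3 := norm_layer_sub_layer_le hLσ hσ (θ.A k) (θ'.A k) (θ.b k) (θ'.b k) u u'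
    have h4 : ‖θ'.A k‖ ≤ c.BA := hθ'.2.1 k
    calc a * ‖layer σ (θ.A k) (θ.b k) u - layer σ (θ'.A k) (θ'.b k) u'‖
        ≤ a * (c.Lσ * (‖θ.A k - θ'.A k‖ * (c.α k * R + c.β k) + c.BA * ‖u - u'‖ +
            ‖θ.b k - θ'.b k‖)) := by
          refine mul_le_mul_of_nonneg_left (h3.trans ?_) ha0
          gcongr
      _ = c.Lσ * c.BA * a * ‖u - u'‖ +
            a * c.Lσ * (c.α k * R + c.β k) * ‖θ.A k - θ'.A k‖ +
            a * c.Lσ * ‖θ.b k - θ'.b k‖ := by ring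
      _ ≤ _ := by
          have h5 := mul_le_mul_of_nonneg_right h1 (norm_nonneg (θ.A k - θ'.A k))
          have h6 := mul_le_mul_of_nonneg_right h2 (norm_nonneg (θ.b k - θ'.b k))
          linarith

theorem norm_vectorField_sub_le (hq : 1 ≤ q) (hLσ : 0 ≤ c.Lσ) (hBA : 0 ≤ c.BA)
    (hσ : ∀ u w, |σ u - σ w| ≤ c.Lσ * |u - w|) (hσ0 : σ 0 = 0) {θ θ' : Param d p q}
    (hθ : θ ∈ c.paramSpace d p q) (hθ' : θ' ∈ c.paramSpace d p q) {R : ℝ} {z : Vec p}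
    (hz : ‖z‖ ≤ R) (z' : Vec p) :
    ‖θ.vectorField σ z - θ'.vectorField σ z'‖ ≤ c.α q * ‖z - z'‖ +
      (⨆ j : Fin q, c.α (q - 1 - j) * c.Lσ * (c.α j * R + c.β j)) * weightDist θ θ' +
      (⨆ j : Fin q, c.α (q - 1 - j) * c.Lσ) * biasDist θ θ' := by
  have ih := norm_hidden_sub_hidden_le hLσ hBA hσ hσ0 hθ hθ' hz z' (Fin.last (q - 1))
  simp only [Fin.castSucc_lt_last, Finset.filter_true] at ih
  set SA := ⨆ j : Fin q, c.α (q - 1 - j) * c.Lσ * (c.α j * R + c.β j) with hSA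
  set Sb := ⨆ j : Fin q, c.α (q - 1 - j) * c.Lσ with hSb
  have h1 : c.Lσ * (c.α (q - 1) * R + c.β (q - 1)) ≤ SA := by
    have := le_ciSup (f := fun j : Fin q => c.α (q - 1 - j) * c.Lσ * (c.α j * R + c.β j))
      (Set.finite_range _).bddAbove ⟨q - 1, by omega⟩
    exact le_trans (le_of_eq (by simp [Consts.α])) this
  have h2 : c.Lσ ≤ Sb := by
    have := le_ciSup (f := fun j : Fin q => c.α (q - 1 - j) * c.Lσ)
      (Set.finite_range _).bddAbove ⟨q - 1, by omega⟩
    exact le_trans (le_of_eq (by simp [Consts.α])) this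
  -- One layer remains after the hidden ones, so the anticipated amplification is a single factor
  -- `Lσ BA`.
  have hα1 : c.α (q - (Fin.last (q - 1) : Fin (q - 1 + 1))) = c.Lσ * c.BA := by
    rw [Fin.val_last, show q - (q - 1) = 1 by omega]
    exact pow_one _
  rw [hα1] at ih
  set u := θ.hidden σ z (Fin.last (q - 1)) with hu
  set u' := θ'.hidden σ z' (Fin.last (q - 1)) with hu'
  have hun : ‖u‖ ≤ c.α (q - 1) * R + c.β (q - 1) := by
    refine (norm_hidden_le hLσ hBA hσ hσ0 hθ z _).trans ?_
    rw [Fin.val_last]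
    gcongr
    exact Consts.α_nonneg hLσ hBA _
  have h3 := norm_layer_sub_layer_le hLσ hσ θ.Alast θ'.Alast
    (WithLp.toLp 2 fun e : Fin p × Fin d => θ.blast e.1 e.2)
    (WithLp.toLp 2 fun e : Fin p × Fin d => θ'.blast e.1 e.2) u u'
  rw [hu, hu', ← Param.toLp_vectorField, ← Param.toLp_vectorField, ← hu, ← hu',
    ← WithLp.toLp_sub, ← WithLp.toLp_sub] at h3
  have e1 := frobenius_norm_eq_norm_uncurry (θ.vectorField σ z - θ'.vectorField σ z')
  have e2 := frobenius_norm_eq_norm_uncurry (θ.blast - θ'.blast)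
  have h4 : ‖θ'.Alast‖ ≤ c.BA := hθ'.2.2.2.1
  have h5 : ‖θ.vectorField σ z - θ'.vectorField σ z'‖ ≤
      c.Lσ * (‖θ.Alast - θ'.Alast‖ * ‖u‖ + ‖θ'.Alast‖ * ‖u - u'‖ + ‖θ.blast - θ'.blast‖) := by
    rw [e1, e2]
    exact h3
  calc _ ≤ _ := h5
    _ ≤ c.Lσ * (‖θ.Alast - θ'.Alast‖ * (c.α (q - 1) * R + c.β (q - 1)) + c.BA * ‖u - u'‖ +
          ‖θ.blast - θ'.blast‖) := by gcongr
    _ = c.Lσ * c.BA * ‖u - u'‖ + c.Lσ * (c.α (q - 1) * R + c.β (q - 1)) *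
          ‖θ.Alast - θ'.Alast‖ + c.Lσ * ‖θ.blast - θ'.blast‖ := by ring
    _ ≤ _ := by
        have h6 := mul_le_mul_of_nonneg_right h1 (norm_nonneg (θ.Alast - θ'.Alast))
        have h7 := mul_le_mul_of_nonneg_right h2 (norm_nonneg (θ.blast - θ'.blast))
        rw [weightDist, biasDist]
        linarith

theorem Param.continuous_hidden (hσ : Continuous σ) (θ : Param d p q) (h : Fin (q - 1 + 1)) :
    Continuous fun z => θ.hidden σ z h := by
  induction h using Fin.induction with
  | zero => exact continuous_id
  | succ h ih =>
    simp only [Param.hidden_succ]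
    exact (continuous_layer hσ _ _).comp ih

theorem Param.continuous_vectorField (hσ : Continuous σ) (θ : Param d p q) :
    Continuous (θ.vectorField σ) := by
  have h := (continuous_layer hσ θ.Alast
    (WithLp.toLp 2 fun e : Fin p × Fin d => θ.blast e.1 e.2)).comp
    (θ.continuous_hidden hσ (Fin.last _))
  exact continuous_matrix fun i j =>
    (continuous_apply (i, j)).comp ((PiLp.continuous_ofLp 2 _).comp h)

end VectorField

/-! ### Bounds on the latent states and the predictions -/

section Predictions

open scoped Matrix.Norms.Frobenius

variable {d p q K : ℕ} {σ : ℝ → ℝ} {c : Consts} {D : Grid K}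

/-- The time series with initial value of norm at most `B` and increments at most `L` times the
sampling gaps. -/
def AdmissibleSeries (D : Grid K) (L B : ℝ) : Set (Fin (K + 1) → Vec d) :=
  {x | ‖x 0‖ ≤ B ∧ ∀ k : Fin K, ‖x k.succ - x k.castSucc‖ ≤ L * (D.t k.succ - D.t k.castSucc)}

theorem Grid.gap_pos (D : Grid K) (k : Fin K) : 0 < D.t k.succ - D.t k.castSucc :=
  sub_pos.2 (D.strictMono k.castSucc_lt_succ)

theorem Grid.gap_le_mesh (D : Grid K) (k : Fin K) : D.t k.succ - D.t k.castSucc ≤ D.mesh :=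
  le_ciSup (f := fun k : Fin K => D.t k.succ - D.t k.castSucc) (Set.finite_range _).bddAbove k

theorem Grid.mesh_nonneg (D : Grid K) : 0 ≤ D.mesh :=
  Real.iSup_nonneg fun k => (D.gap_pos k).le

theorem Grid.t_nonneg (D : Grid K) (k : Fin (K + 1)) : 0 ≤ D.t k := by
  rw [← D.t_zero]
  exact D.strictMono.monotone (Fin.zero_le k)

theorem Grid.t_le_one (D : Grid K) (k : Fin (K + 1)) : D.t k ≤ 1 := by
  rw [← D.t_last]
  exact D.strictMono.monotone (Fin.le_last k)

theorem Grid.fillForward_t {E : Type*} (D : Grid K) (x : Fin (K + 1) → E) (k : Fin (K + 1)) :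
    D.fillForward x (D.t k) = x k := by
  rw [Grid.fillForward, D.lastIndex_t]

theorem measurableSet_admissibleSeries (D : Grid K) (L B : ℝ) :
    MeasurableSet (AdmissibleSeries (d := d) D L B) := by
  have : AdmissibleSeries (d := d) D L B = {x | ‖x 0‖ ≤ B} ∩ ⋂ k : Fin K,
      {x | ‖x k.succ - x k.castSucc‖ ≤ L * (D.t k.succ - D.t k.castSucc)} := by
    ext x
    simp [AdmissibleSeries]
  rw [this]
  refine (measurableSet_le (by fun_prop) measurable_const).inter
    (MeasurableSet.iInter fun k => measurableSet_le (by fun_prop) measurable_const)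

theorem IsAdmissiblePath.sample_mem {L B : ℝ} {x : ℝ → Vec d} (hx : IsAdmissiblePath L B x) :
    D.sample x ∈ AdmissibleSeries D L B := by
  refine ⟨?_, fun k => ?_⟩
  · rw [Grid.sample, D.t_zero]
    exact hx.2
  · have h := hx.1 (D.t k.castSucc) ⟨D.t_nonneg _, D.t_le_one _⟩ (D.t k.succ)
      ⟨D.t_nonneg _, D.t_le_one _⟩
    rwa [abs_of_pos (D.gap_pos k)] at h

/-- The latent state at the `k`-th sampling time. -/
noncomputable def latentState (σ : ℝ → ℝ) (θ : Param d p q) (D : Grid K)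
    (x : Fin (K + 1) → Vec d) (k : Fin (K + 1)) : Vec p :=
  θ.latentGrid σ D (D.fillForward x) k

theorem latentState_zero (θ : Param d p q) (x : Fin (K + 1) → Vec d) :
    latentState σ θ D x 0 = θ.init σ (x 0) := by
  change θ.init σ (D.fillForward x 0) = _
  rw [← D.t_zero, D.fillForward_t]

theorem latentState_succ (θ : Param d p q) (x : Fin (K + 1) → Vec d) (k : Fin K) :
    latentState σ θ D x k.succ = latentState σ θ D x k.castSucc +
      WithLp.toLp 2 ((θ.vectorField σ (latentState σ θ D x k.castSucc)).mulVec
        (x k.succ - x k.castSucc).ofLp) := by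
  change latentState σ θ D x k.castSucc + WithLp.toLp 2 ((θ.vectorField σ
    (latentState σ θ D x k.castSucc)).mulVec
      (D.fillForward x (D.t k.succ) - D.fillForward x (D.t k.castSucc)).ofLp) = _
  rw [D.fillForward_t, D.fillForward_t]

theorem predict_eq_inner_latentState (θ : Param d p q) (x : Fin (K + 1) → Vec d) :
    θ.predict σ D x = inner ℝ θ.readout (latentState σ θ D x (Fin.last K)) := by
  rw [Param.predict, Param.latent, ← D.t_last, D.lastIndex_t]
  rfl

/-- Continuity in the series serves to make the truncated loss measurable. -/
theorem continuous_latentState (hσ : Continuous σ) (θ : Param d p q) (k : Fin (K + 1)) :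
    Continuous fun x => latentState σ θ D x k := by
  induction k using Fin.induction with
  | zero =>
    simp only [latentState_zero, Param.init_eq_layer]
    exact (continuous_layer hσ _ _).comp (continuous_apply 0)
  | succ k ih =>
    simp only [latentState_succ]
    refine ih.add ((PiLp.continuous_toLp 2 _).comp ?_)
    exact ((θ.continuous_vectorField hσ).comp ih).matrix_mulVec
      ((PiLp.continuous_ofLp 2 _).comp ((continuous_apply _).sub (continuous_apply _)))

theorem continuous_predict (hσ : Continuous σ) (θ : Param d p q) :
    Continuous (θ.predict σ D) := by
  simp only [funext (predict_eq_inner_latentState θ)]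
  exact continuous_const.inner (continuous_latentState hσ θ _)

/-- The assumptions on the constants, the activation function and the depth. -/
structure Regular (c : Consts) (σ : ℝ → ℝ) (q : ℕ) : Prop where
  one_le_q : 1 ≤ q
  one_le_Lσ : 1 ≤ c.Lσ
  Lx_nonneg : 0 ≤ c.Lx
  Bx_nonneg : 0 ≤ c.Bx
  BΦ_nonneg : 0 ≤ c.BΦ
  BA_nonneg : 0 ≤ c.BA
  Bb_nonneg : 0 ≤ c.Bb
  BU_nonneg : 0 ≤ c.BU
  Bv_nonneg : 0 ≤ c.Bv
  lipschitz : ∀ u w, |σ u - σ w| ≤ c.Lσ * |u - w|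
  map_zero : σ 0 = 0

namespace Regular

variable (hc : Regular c σ q)
include hc

theorem Lσ_nonneg : 0 ≤ c.Lσ := zero_le_one.trans hc.one_le_Lσ

theorem α_nonneg (h : ℕ) : 0 ≤ c.α h := Consts.α_nonneg hc.Lσ_nonneg hc.BA_nonneg h

theorem β_nonneg (h : ℕ) : 0 ≤ c.β h :=
  Consts.β_nonneg hc.Lσ_nonneg hc.BA_nonneg hc.Bb_nonneg h

theorem radius_nonneg (D : Grid K) : 0 ≤ c.radius D q := by
  have := hc.Lσ_nonneg
  have := hc.Lx_nonneg
  have := hc.Bx_nonneg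
  have := hc.BU_nonneg
  have := hc.Bv_nonneg
  have := hc.α_nonneg q
  have := hc.β_nonneg q
  have := D.mesh_nonneg
  unfold Consts.radius
  positivity

theorem M_nonneg (D : Grid K) : 0 ≤ c.M D q := mul_nonneg hc.BΦ_nonneg (hc.radius_nonneg D)

theorem CA_nonneg (D : Grid K) : 0 ≤ c.CA D q := by
  refine mul_nonneg (mul_nonneg (mul_nonneg hc.BΦ_nonneg hc.Lx_nonneg) (Real.exp_pos _).le)
    (Real.iSup_nonneg fun j => ?_)
  have := hc.Lσ_nonneg
  have := hc.α_nonneg (q - 1 - j)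
  have := hc.α_nonneg j
  have := hc.β_nonneg j
  have := hc.radius_nonneg D
  positivity

theorem Cb_nonneg : 0 ≤ c.Cb q :=
  mul_nonneg (mul_nonneg (mul_nonneg hc.BΦ_nonneg hc.Lx_nonneg) (Real.exp_pos _).le)
    (Real.iSup_nonneg fun _ => mul_nonneg (hc.α_nonneg _) hc.Lσ_nonneg)

theorem CU_nonneg : 0 ≤ c.CU q :=
  mul_nonneg (mul_nonneg (mul_nonneg hc.BΦ_nonneg hc.Bx_nonneg) (Real.exp_pos _).le)
    hc.Lσ_nonneg

theorem Cv_nonneg : 0 ≤ c.Cv q :=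
  mul_nonneg (mul_nonneg hc.BΦ_nonneg (Real.exp_pos _).le) hc.Lσ_nonneg

theorem continuous : Continuous σ :=
  LipschitzWith.continuous (K := Real.toNNReal c.Lσ) <| LipschitzWith.of_dist_le_mul fun u w => by
    rw [Real.dist_eq, Real.dist_eq, Real.coe_toNNReal _ hc.Lσ_nonneg]
    exact hc.lipschitz u w

/-- Discrete Grönwall: a step multiplies the norm by at most `1 + α_q Lx |D|` and adds at most `β_q
Lx` times the gap; the gaps up to the `k`-th time sum to `t_k`. -/
theorem norm_latentState_le_pow {θ : Param d p q} (hθ : θ ∈ c.paramSpace d p q)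
    {x : Fin (K + 1) → Vec d} (hx : x ∈ AdmissibleSeries D c.Lx c.Bx) (k : Fin (K + 1)) :
    ‖latentState σ θ D x k‖ ≤ (1 + c.α q * c.Lx * D.mesh) ^ (k : ℕ) *
      (c.Lσ * (c.BU * c.Bx + c.Bv) + c.β q * c.Lx * D.t k) := by
  have hL := hc.Lσ_nonneg
  have hLx := hc.Lx_nonneg
  have hα := hc.α_nonneg q
  have hβ := hc.β_nonneg q
  have hm := D.mesh_nonneg
  have hC : 0 ≤ c.BU * c.Bx + c.Bv :=
    add_nonneg (mul_nonneg hc.BU_nonneg hc.Bx_nonneg) hc.Bv_nonneg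
  induction k using Fin.induction with
  | zero =>
    rw [latentState_zero, Param.init_eq_layer, D.t_zero, Fin.val_zero, pow_zero, one_mul, mul_zero,
      add_zero]
    refine (norm_layer_le hL hc.lipschitz hc.map_zero _ _ _).trans ?_
    exact mul_le_mul_of_nonneg_left (add_le_add
      (mul_le_mul hθ.2.2.2.2.2.1 hx.1 (norm_nonneg _) hc.BU_nonneg) hθ.2.2.2.2.2.2) hL
  | succ k ih =>
    rw [latentState_succ, Fin.val_succ]
    rw [Fin.val_castSucc] at ih
    set z := latentState σ θ D x k.castSucc
    set ρ := 1 + c.α q * c.Lx * D.mesh with hρ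
    set Δ := D.t k.succ - D.t k.castSucc with hΔ
    have hρ1 : 1 ≤ ρ := le_add_of_nonneg_right (by positivity)
    have hΔ0 : 0 ≤ Δ := (D.gap_pos k).le
    have hinc : ‖WithLp.toLp 2 ((θ.vectorField σ z).mulVec (x k.succ - x k.castSucc).ofLp)‖ ≤
        (c.α q * ‖z‖ + c.β q) * (c.Lx * Δ) :=
      (norm_mulVec_le _ _).trans (mul_le_mul
        (norm_vectorField_le hc.one_le_q hL hc.BA_nonneg hc.lipschitz hc.map_zero hθ z)
        (hx.2 k) (norm_nonneg _) (by positivity))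
    have h1 : ‖z‖ + (c.α q * ‖z‖ + c.β q) * (c.Lx * Δ) ≤ ρ * ‖z‖ + c.β q * c.Lx * Δ := by
      have h2 : c.α q * c.Lx * Δ * ‖z‖ ≤ c.α q * c.Lx * D.mesh * ‖z‖ := by
        gcongr
        exact D.gap_le_mesh k
      rw [hρ]
      linarith
    have h3 : ρ * ‖z‖ ≤ ρ * (ρ ^ (k : ℕ) * (c.Lσ * (c.BU * c.Bx + c.Bv) +
        c.β q * c.Lx * D.t k.castSucc)) := mul_le_mul_of_nonneg_left ih (by linarith)
    have h4 : 1 * (c.β q * c.Lx * Δ) ≤ ρ ^ ((k : ℕ) + 1) * (c.β q * c.Lx * Δ) :=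
      mul_le_mul_of_nonneg_right (one_le_pow₀ hρ1) (by positivity)
    have h5 : D.t k.succ = D.t k.castSucc + Δ := by rw [hΔ]; ring
    rw [h5]
    calc _ ≤ _ := norm_add_le _ _
      _ ≤ ‖z‖ + (c.α q * ‖z‖ + c.β q) * (c.Lx * Δ) := add_le_add_right hinc _
      _ ≤ _ := h1
      _ ≤ ρ * (ρ ^ (k : ℕ) * (c.Lσ * (c.BU * c.Bx + c.Bv) + c.β q * c.Lx * D.t k.castSucc)) +
          ρ ^ ((k : ℕ) + 1) * (c.β q * c.Lx * Δ) := by linarith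
      _ = _ := by rw [pow_succ']; ring

theorem norm_latentState_le {θ : Param d p q} (hθ : θ ∈ c.paramSpace d p q)
    {x : Fin (K + 1) → Vec d} (hx : x ∈ AdmissibleSeries D c.Lx c.Bx) (k : Fin (K + 1)) :
    ‖latentState σ θ D x k‖ ≤ c.radius D q := by
  have hL := hc.Lσ_nonneg
  have hLx := hc.Lx_nonneg
  have hα := hc.α_nonneg q
  have hβ := hc.β_nonneg q
  have hm := D.mesh_nonneg
  have hC : 0 ≤ c.BU * c.Bx + c.Bv :=
    add_nonneg (mul_nonneg hc.BU_nonneg hc.Bx_nonneg) hc.Bv_nonneg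
  refine (hc.norm_latentState_le_pow hθ hx k).trans ?_
  -- Here `Lσ ≥ 1`, rather than mere nonnegativity, allows the drift term to share the common factor
  -- `Lσ` of the radius.
  have h1 : c.β q * c.Lx * D.t k ≤ c.Lσ * (c.β q * c.Lx) := by
    have h2 := mul_le_mul_of_nonneg_left (D.t_le_one k) (by positivity : 0 ≤ c.β q * c.Lx)
    have h3 := mul_le_mul_of_nonneg_right hc.one_le_Lσ (by positivity : 0 ≤ c.β q * c.Lx)
    linarith
  have h4 : (1 + c.α q * c.Lx * D.mesh) ^ (k : ℕ) ≤ (1 + c.α q * c.Lx * D.mesh) ^ K :=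
    pow_le_pow_right₀ (le_add_of_nonneg_right (by positivity)) (Nat.le_of_lt_succ k.isLt)
  have h5 := D.t_nonneg k
  calc _ ≤ (1 + c.α q * c.Lx * D.mesh) ^ K *
        (c.Lσ * (c.BU * c.Bx + c.Bv) + c.Lσ * (c.β q * c.Lx)) := by gcongr
    _ = _ := by
        rw [Consts.radius]
        ring

theorem abs_predict_le {θ : Param d p q} (hθ : θ ∈ c.paramSpace d p q)
    {x : Fin (K + 1) → Vec d} (hx : x ∈ AdmissibleSeries D c.Lx c.Bx) :
    |θ.predict σ D x| ≤ c.M D q := by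
  rw [predict_eq_inner_latentState]
  exact (abs_real_inner_le_norm _ _).trans
    (mul_le_mul hθ.1 (hc.norm_latentState_le hθ hx _) (norm_nonneg _) hc.BΦ_nonneg)

/-- Discrete Grönwall again, now with `1 + u ≤ exp u` at each step: the factors multiply to `exp
(α_q Lx t_k)`, which does not depend on the number of grid points. -/
theorem norm_latentState_sub_le {θ θ' : Param d p q} (hθ : θ ∈ c.paramSpace d p q)
    (hθ' : θ' ∈ c.paramSpace d p q) {x : Fin (K + 1) → Vec d}
    (hx : x ∈ AdmissibleSeries D c.Lx c.Bx) (k : Fin (K + 1)) :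
    ‖latentState σ θ D x k - latentState σ θ' D x k‖ ≤ Real.exp (c.α q * c.Lx * D.t k) *
      (c.Lσ * (‖θ.U - θ'.U‖ * c.Bx + ‖θ.v - θ'.v‖) + c.Lx *
        ((⨆ j : Fin q, c.α (q - 1 - j) * c.Lσ * (c.α j * c.radius D q + c.β j)) *
          weightDist θ θ' + (⨆ j : Fin q, c.α (q - 1 - j) * c.Lσ) * biasDist θ θ') *
            D.t k) := by
  have hL := hc.Lσ_nonneg
  have hLx := hc.Lx_nonneg
  have hα := hc.α_nonneg q
  have hg : ∀ k : Fin K, ‖θ.vectorField σ (latentState σ θ D x k.castSucc) -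
      θ'.vectorField σ (latentState σ θ' D x k.castSucc)‖ ≤ _ := fun k =>
    norm_vectorField_sub_le hc.one_le_q hL hc.BA_nonneg hc.lipschitz hc.map_zero hθ hθ'
      (hc.norm_latentState_le hθ hx k.castSucc) (latentState σ θ' D x k.castSucc)
  simp only [add_assoc] at hg
  set g := (⨆ j : Fin q, c.α (q - 1 - j) * c.Lσ * (c.α j * c.radius D q + c.β j)) *
    weightDist θ θ' + (⨆ j : Fin q, c.α (q - 1 - j) * c.Lσ) * biasDist θ θ' with hg_def
  have hg0 : 0 ≤ g := by
    refine add_nonneg (mul_nonneg (Real.iSup_nonneg fun j => ?_) ?_)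
      (mul_nonneg (Real.iSup_nonneg fun j => mul_nonneg (hc.α_nonneg _) hL) ?_)
    · exact mul_nonneg (mul_nonneg (hc.α_nonneg _) hL) (add_nonneg
        (mul_nonneg (hc.α_nonneg _) (hc.radius_nonneg D)) (hc.β_nonneg _))
    · exact add_nonneg (Finset.sum_nonneg fun _ _ => norm_nonneg _) (norm_nonneg _)
    · exact add_nonneg (Finset.sum_nonneg fun _ _ => norm_nonneg _) (norm_nonneg _)
  induction k using Fin.induction with
  | zero =>
    rw [latentState_zero, latentState_zero, Param.init_eq_layer, Param.init_eq_layer, D.t_zero,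
      mul_zero, mul_zero, Real.exp_zero, one_mul, add_zero]
    refine (norm_layer_sub_layer_le hL hc.lipschitz _ _ _ _ _ _).trans ?_
    rw [sub_self, norm_zero, mul_zero, add_zero]
    gcongr
    exact hx.1
  | succ k ih =>
    specialize hg k
    rw [latentState_succ, latentState_succ]
    set z := latentState σ θ D x k.castSucc
    set z' := latentState σ θ' D x k.castSucc
    set d0 := c.Lσ * (‖θ.U - θ'.U‖ * c.Bx + ‖θ.v - θ'.v‖)
    set Δ := D.t k.succ - D.t k.castSucc with hΔ
    have hΔ0 : 0 ≤ Δ := (D.gap_pos k).le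
    have h5 : D.t k.succ = D.t k.castSucc + Δ := by rw [hΔ]; ring
    have ht := D.t_nonneg k.castSucc
    have e : z + WithLp.toLp 2 ((θ.vectorField σ z).mulVec (x k.succ - x k.castSucc).ofLp) -
        (z' + WithLp.toLp 2 ((θ'.vectorField σ z').mulVec (x k.succ - x k.castSucc).ofLp)) =
        (z - z') + WithLp.toLp 2 ((θ.vectorField σ z - θ'.vectorField σ z').mulVec
          (x k.succ - x k.castSucc).ofLp) := by
      rw [Matrix.sub_mulVec, WithLp.toLp_sub]
      abel
    have hinc : ‖WithLp.toLp 2 ((θ.vectorField σ z - θ'.vectorField σ z').mulVec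
        (x k.succ - x k.castSucc).ofLp)‖ ≤ (c.α q * ‖z - z'‖ + g) * (c.Lx * Δ) :=
      (norm_mulVec_le _ _).trans (mul_le_mul hg (hx.2 k) (norm_nonneg _) (by positivity))
    have h1 : 1 + c.α q * c.Lx * Δ ≤ Real.exp (c.α q * c.Lx * Δ) := by
      linarith [Real.add_one_le_exp (c.α q * c.Lx * Δ)]
    have h2 : 1 * (c.Lx * g * Δ) ≤
        Real.exp (c.α q * c.Lx * (D.t k.castSucc + Δ)) * (c.Lx * g * Δ) :=
      mul_le_mul_of_nonneg_right (Real.one_le_exp (by positivity)) (by positivity)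
    rw [e, h5]
    calc _ ≤ _ := norm_add_le _ _
      _ ≤ ‖z - z'‖ + (c.α q * ‖z - z'‖ + g) * (c.Lx * Δ) := add_le_add_right hinc _
      _ = (1 + c.α q * c.Lx * Δ) * ‖z - z'‖ + 1 * (c.Lx * g * Δ) := by ring
      _ ≤ Real.exp (c.α q * c.Lx * Δ) * (Real.exp (c.α q * c.Lx * D.t k.castSucc) *
            (d0 + c.Lx * g * D.t k.castSucc)) +
          Real.exp (c.α q * c.Lx * (D.t k.castSucc + Δ)) * (c.Lx * g * Δ) :=
          add_le_add (mul_le_mul h1 ih (norm_nonneg _) (Real.exp_pos _).le) h2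
      _ = _ := by
          rw [mul_add (c.α q * c.Lx), Real.exp_add]
          ring

/-- The predictions are Lipschitz continuous in the parameters. -/
theorem abs_predict_sub_le {θ θ' : Param d p q} (hθ : θ ∈ c.paramSpace d p q)
    (hθ' : θ' ∈ c.paramSpace d p q) {x : Fin (K + 1) → Vec d}
    (hx : x ∈ AdmissibleSeries D c.Lx c.Bx) :
    |θ.predict σ D x - θ'.predict σ D x| ≤ c.radius D q * ‖θ.readout - θ'.readout‖ +
      c.CA D q * weightDist θ θ' + c.Cb q * biasDist θ θ' + c.CU q * ‖θ.U - θ'.U‖ +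
        c.Cv q * ‖θ.v - θ'.v‖ := by
  rw [predict_eq_inner_latentState, predict_eq_inner_latentState]
  have hz := hc.norm_latentState_sub_le hθ hθ' hx (Fin.last K)
  have hR := hc.norm_latentState_le hθ hx (Fin.last K)
  rw [D.t_last, mul_one, mul_one] at hz
  set z := latentState σ θ D x (Fin.last K)
  set z' := latentState σ θ' D x (Fin.last K)
  have e : inner ℝ θ.readout z - inner ℝ θ'.readout z' =
      inner ℝ (θ.readout - θ'.readout) z + inner ℝ θ'.readout (z - z') := by
    rw [inner_sub_left, inner_sub_right]
    ring
  have h1 := (abs_real_inner_le_norm (θ.readout - θ'.readout) z).trans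
    (mul_le_mul_of_nonneg_left hR (norm_nonneg _))
  have h2 := (abs_real_inner_le_norm θ'.readout (z - z')).trans
    (mul_le_mul hθ'.1 hz (norm_nonneg _) hc.BΦ_nonneg)
  rw [e]
  refine (abs_add_le _ _).trans ((add_le_add h1 h2).trans (le_of_eq ?_))
  rw [Consts.CA, Consts.Cb, Consts.CU, Consts.Cv]
  ring

end Regular

end Predictions

/-! ### Nets of the parameter space -/

section ParamNets

open scoped Matrix.Norms.Frobenius

variable {d p q K n : ℕ} {σ : ℝ → ℝ} {c : Consts} {D : Grid K}

/-- The parameters assembled from a tuple. -/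
def Param.ofTuple (w : Vec p × (Fin (q - 1) → Matrix (Fin p) (Fin p) ℝ) × (Fin (q - 1) → Vec p) ×
    Matrix (Fin p × Fin d) (Fin p) ℝ × Matrix (Fin p) (Fin d) ℝ × Matrix (Fin p) (Fin d) ℝ ×
    Vec p) : Param d p q :=
  ⟨w.1, w.2.1, w.2.2.1, w.2.2.2.1, w.2.2.2.2.1, w.2.2.2.2.2.1, w.2.2.2.2.2.2⟩

theorem finrank_matrix_real (ι κ : Type*) [Fintype ι] [Fintype κ] :
    Module.finrank ℝ (Matrix ι κ ℝ) = Fintype.card ι * Fintype.card κ := by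
  simpa using Module.finrank_matrix ℝ ℝ ι κ

/-- A product of nets of balls. The error is shared equally among `2 q + 3` blocks: the readout, `q`
weights, `q` biases, `U` and `v`. The readout and `v` account for the exponent `2 p`, the hidden
layers for `(q - 1) p (p + 1)`, and the last layer with `U` for `d p (2 + p)`. -/
theorem Regular.exists_param_net (hc : Regular c σ q) (d p : ℕ) (D : Grid K) {e : ℝ}
    (he : 0 < e) :
    ∃ S : Finset (Param d p q), S.Nonempty ∧ ↑S ⊆ c.paramSpace d p q ∧
      (∀ θ ∈ c.paramSpace d p q, ∃ θ' ∈ S, ∀ x ∈ AdmissibleSeries D c.Lx c.Bx,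
        |θ.predict σ D x - θ'.predict σ D x| ≤ e) ∧
      (S.card : ℝ) ≤ (1 + 2 * c.K₁ D q / (e / (2 * q + 3))) ^ (2 * p) *
        ((1 + 2 * c.K₂ D q / (e / (2 * q + 3))) ^ ((q - 1) * p * (p + 1)) *
          (1 + 2 * c.K₂ D q / (e / (2 * q + 3))) ^ (d * p * (2 + p))) := by
  classical
  set η : ℝ := e / (2 * q + 3) with hη_def
  have hη : 0 < η := by positivity
  obtain ⟨SΦ, hΦ0, hΦB, hΦ, hΦc⟩ := exists_finset_net (E := Vec p) hc.BΦ_nonneg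
    (hc.radius_nonneg D) hη
  obtain ⟨SA, hA0, hAB, hA, hAc⟩ := exists_finset_net (E := Matrix (Fin p) (Fin p) ℝ) hc.BA_nonneg
    (hc.CA_nonneg D) hη
  obtain ⟨Sb, hb0, hbB, hb, hbc⟩ := exists_finset_net (E := Vec p) hc.Bb_nonneg hc.Cb_nonneg hη
  obtain ⟨SA', hA'0, hA'B, hA', hA'c⟩ := exists_finset_net
    (E := Matrix (Fin p × Fin d) (Fin p) ℝ) hc.BA_nonneg (hc.CA_nonneg D) hη
  obtain ⟨Sb', hb'0, hb'B, hb', hb'c⟩ := exists_finset_net (E := Matrix (Fin p) (Fin d) ℝ)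
    hc.Bb_nonneg hc.Cb_nonneg hη
  obtain ⟨SU, hU0, hUB, hU, hUc⟩ := exists_finset_net (E := Matrix (Fin p) (Fin d) ℝ)
    hc.BU_nonneg hc.CU_nonneg hη
  obtain ⟨Sv, hv0, hvB, hv, hvc⟩ := exists_finset_net (E := Vec p) hc.Bv_nonneg hc.Cv_nonneg hη
  refine ⟨(SΦ ×ˢ Fintype.piFinset (fun _ => SA) ×ˢ Fintype.piFinset (fun _ => Sb) ×ˢ SA' ×ˢ
    Sb' ×ˢ SU ×ˢ Sv).image Param.ofTuple, ?_, ?_, ?_, ?_⟩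
  · refine Finset.Nonempty.image ?_ _
    simp only [Finset.nonempty_product, Fintype.piFinset_nonempty]
    exact ⟨hΦ0, fun _ => hA0, fun _ => hb0, hA'0, hb'0, hU0, hv0⟩
  · intro θ hθ
    obtain ⟨w, hw, rfl⟩ := Finset.mem_image.1 (Finset.mem_coe.1 hθ)
    simp only [Finset.mem_product, Fintype.mem_piFinset] at hw
    obtain ⟨h1, h2, h3, h4, h5, h6, h7⟩ := hw
    exact ⟨hΦB _ h1, fun h => hAB _ (h2 h), fun h => hbB _ (h3 h), hA'B _ h4, hb'B _ h5,
      hUB _ h6, hvB _ h7⟩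
  · intro θ hθ
    obtain ⟨h1, h2, h3, h4, h5, h6, h7⟩ := id hθ
    obtain ⟨wΦ, wΦS, hwΦ⟩ := hΦ _ h1
    choose wA wAS hwA using fun h => hA _ (h2 h)
    choose wb wbS hwb using fun h => hb _ (h3 h)
    obtain ⟨wA', wA'S, hwA'⟩ := hA' _ h4
    obtain ⟨wb', wb'S, hwb'⟩ := hb' _ h5
    obtain ⟨wU, wUS, hwU⟩ := hU _ h6
    obtain ⟨wv, wvS, hwv⟩ := hv _ h7
    refine ⟨Param.ofTuple (wΦ, wA, wb, wA', wb', wU, wv), Finset.mem_image_of_mem _ ?_,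
      fun x hx => ?_⟩
    · simp only [Finset.mem_product, Fintype.mem_piFinset]
      exact ⟨wΦS, wAS, wbS, wA'S, wb'S, wUS, wvS⟩
    · have hmem : Param.ofTuple (wΦ, wA, wb, wA', wb', wU, wv) ∈ c.paramSpace d p q :=
        ⟨hΦB _ wΦS, fun h => hAB _ (wAS h), fun h => hbB _ (wbS h), hA'B _ wA'S, hb'B _ wb'S,
          hUB _ wUS, hvB _ wvS⟩
      refine (hc.abs_predict_sub_le hθ hmem hx).trans ?_
      have hq1 : ((q - 1 : ℕ) : ℝ) = q - 1 := by
        have := hc.one_le_q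
        push_cast [this]
        ring
      have hW : c.CA D q * weightDist θ (Param.ofTuple (wΦ, wA, wb, wA', wb', wU, wv)) ≤
          q * η := by
        rw [weightDist, mul_add, Finset.mul_sum]
        have := Finset.sum_le_card_nsmul Finset.univ
          (fun h => c.CA D q * ‖θ.A h - wA h‖) η fun h _ => hwA h
        rw [Finset.card_univ, Fintype.card_fin, nsmul_eq_mul, hq1] at this
        calc _ ≤ ((q : ℝ) - 1) * η + η := add_le_add this hwA'
          _ = _ := by ring
      have hV : c.Cb q * biasDist θ (Param.ofTuple (wΦ, wA, wb, wA', wb', wU, wv)) ≤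
          q * η := by
        rw [biasDist, mul_add, Finset.mul_sum]
        have := Finset.sum_le_card_nsmul Finset.univ
          (fun h => c.Cb q * ‖θ.b h - wb h‖) η fun h _ => hwb h
        rw [Finset.card_univ, Fintype.card_fin, nsmul_eq_mul, hq1] at this
        calc _ ≤ ((q : ℝ) - 1) * η + η := add_le_add this hwb'
          _ = _ := by ring
      calc _ ≤ η + q * η + q * η + η + η :=
            add_le_add (add_le_add (add_le_add (add_le_add hwΦ hW) hV) hwU) hwv
        _ = (2 * q + 3) * η := by ring
        _ = e := by rw [hη_def]; field_simp
  · have hK₁Φ : c.BΦ * c.radius D q ≤ c.K₁ D q := le_max_left _ _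
    have hK₁v : c.Bv * c.Cv q ≤ c.K₁ D q := le_max_right _ _
    have hK₂b : c.Bb * c.Cb q ≤ c.K₂ D q := le_max_left _ _
    have hK₂A : c.BA * c.CA D q ≤ c.K₂ D q := (le_max_left _ _).trans (le_max_right _ _)
    have hK₂U : c.BU * c.CU q ≤ c.K₂ D q := (le_max_right _ _).trans (le_max_right _ _)
    set T₁ := 1 + 2 * c.K₁ D q / η with hT₁
    set T₂ := 1 + 2 * c.K₂ D q / η with hT₂
    have mono : ∀ {B C T : ℝ} {m m' N : ℕ}, 0 ≤ B → 0 ≤ C → B * C ≤ T →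
        (N : ℝ) ≤ (1 + 2 * (B * C) / η) ^ m → m = m' → (N : ℝ) ≤ (1 + 2 * T / η) ^ m' := by
      rintro B C T m _ N hB hC hT hN rfl
      refine hN.trans ?_
      have := mul_nonneg hB hC
      gcongr
    have cΦ := mono hc.BΦ_nonneg (hc.radius_nonneg D) hK₁Φ hΦc finrank_euclideanSpace_fin
    have cA := mono hc.BA_nonneg (hc.CA_nonneg D) hK₂A hAc (m' := p * p)
      ((finrank_matrix_real _ _).trans (by simp))
    have cb := mono hc.Bb_nonneg hc.Cb_nonneg hK₂b hbc finrank_euclideanSpace_fin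
    have cA' := mono hc.BA_nonneg (hc.CA_nonneg D) hK₂A hA'c (m' := p * d * p)
      ((finrank_matrix_real _ _).trans (by simp))
    have cb' := mono hc.Bb_nonneg hc.Cb_nonneg hK₂b hb'c (m' := p * d)
      ((finrank_matrix_real _ _).trans (by simp))
    have cU := mono hc.BU_nonneg hc.CU_nonneg hK₂U hUc (m' := p * d)
      ((finrank_matrix_real _ _).trans (by simp))
    have cv := mono hc.Bv_nonneg hc.Cv_nonneg hK₁v hvc finrank_euclideanSpace_fin
    have hcard := Finset.card_image_le (f := Param.ofTuple (d := d) (p := p) (q := q))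
      (s := SΦ ×ˢ Fintype.piFinset (fun _ => SA) ×ˢ Fintype.piFinset (fun _ => Sb) ×ˢ SA' ×ˢ
        Sb' ×ˢ SU ×ˢ Sv)
    simp only [Finset.card_product, Fintype.card_piFinset_const] at hcard
    have hcard' : ((((SΦ ×ˢ Fintype.piFinset (fun _ => SA) ×ˢ Fintype.piFinset (fun _ => Sb) ×ˢ
        SA' ×ˢ Sb' ×ˢ SU ×ˢ Sv).image (Param.ofTuple (q := q))).card : ℕ) : ℝ) ≤
        SΦ.card * (SA.card ^ (q - 1) * (Sb.card ^ (q - 1) * (SA'.card * (Sb'.card *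
          (SU.card * Sv.card))))) := by exact_mod_cast hcard
    have hT₁0 : 0 ≤ T₁ := by
      have : 0 ≤ c.K₁ D q := (mul_nonneg hc.BΦ_nonneg (hc.radius_nonneg D)).trans hK₁Φ
      positivity
    have hT₂0 : 0 ≤ T₂ := by
      have : 0 ≤ c.K₂ D q := (mul_nonneg hc.Bb_nonneg hc.Cb_nonneg).trans hK₂b
      positivity
    refine hcard'.trans ?_
    calc _ ≤ T₁ ^ p * ((T₂ ^ (p * p)) ^ (q - 1) * ((T₂ ^ p) ^ (q - 1) * (T₂ ^ (p * d * p) *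
          (T₂ ^ (p * d) * (T₂ ^ (p * d) * T₁ ^ p))))) := by gcongr
      _ = _ := by ring

/-- Because `y ≥ 2`, each halving of the scale costs at most one more factor `y`; hence logarithmic
net sizes grow linearly in `k`. -/
theorem log_one_add_two_pow_mul_le {y : ℝ} (hy : 2 ≤ y) (k : ℕ) :
    Real.log (1 + 2 ^ k * y) ≤ (k + 2) * Real.log y := by
  have h1 : (1 : ℝ) ≤ 2 ^ k := one_le_pow₀ (by norm_num)
  have h2 : (2 : ℝ) ^ (k + 1) ≤ y ^ (k + 1) := pow_le_pow_left₀ (by norm_num) hy _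
  have h3 : 1 + 2 ^ k * y ≤ y ^ (k + 2) := by
    calc 1 + 2 ^ k * y ≤ 2 ^ k * y + 2 ^ k * y := by nlinarith
      _ = 2 ^ (k + 1) * y := by ring
      _ ≤ y ^ (k + 1) * y := mul_le_mul_of_nonneg_right h2 (by linarith)
      _ = _ := by ring
  calc _ ≤ Real.log (y ^ (k + 2)) := Real.log_le_log (by positivity) h3
    _ = _ := by
        rw [Real.log_pow]
        push_cast
        ring

theorem Consts.M_pos (hn : 1 ≤ n) (hnM : 1 / √n ≤ 2 * c.M D q) : 0 < c.M D q := by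
  have : (0 : ℝ) < n := by exact_mod_cast hn
  have : 0 < 1 / √(n : ℝ) := by positivity
  linarith

theorem Consts.two_le_K₁ (hn : 1 ≤ n) (hnM : 1 / √n ≤ 2 * c.M D q) :
    2 ≤ √n * Consts.Cq q * c.K₁ D q := by
  have hn0 : (0 : ℝ) < n := by exact_mod_cast hn
  rw [div_le_iff₀ (by positivity)] at hnM
  have h1 : c.M D q ≤ c.K₁ D q := le_max_left _ _
  have h2 := mul_le_mul_of_nonneg_right h1 (Real.sqrt_nonneg n)
  have h3 : (1 : ℝ) / 2 ≤ √n * c.K₁ D q := by linarith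
  have h4 := mul_le_mul_of_nonneg_left h3 (by positivity : (0 : ℝ) ≤ 8 * q + 12)
  unfold Consts.Cq
  have h5 : (0 : ℝ) ≤ q := Nat.cast_nonneg q
  linarith

/-- The second sample-size condition is exactly this inequality, as `Cq = 2 (4 q + 6)`. -/
theorem Consts.two_le_K₂ (hn : 1 ≤ n) (hnK : 1 / √n ≤ (4 * q + 6) * √p * c.K₂ D q) :
    2 ≤ √(n * p) * Consts.Cq q * c.K₂ D q := by
  have hn0 : (0 : ℝ) < n := by exact_mod_cast hn
  rw [div_le_iff₀ (by positivity)] at hnK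
  rw [Real.sqrt_mul hn0.le]
  unfold Consts.Cq
  linarith

namespace Regular

variable (hc : Regular c σ q)
include hc

theorem K₁_nonneg (D : Grid K) : 0 ≤ c.K₁ D q := (hc.M_nonneg D).trans (le_max_left _ _)

theorem K₂_nonneg (D : Grid K) : 0 ≤ c.K₂ D q :=
  (mul_nonneg hc.Bb_nonneg hc.Cb_nonneg).trans (le_max_left _ _)

theorem K₂_le_K₂ (hd : 1 ≤ d) :
    √(n * p) * Consts.Cq q * c.K₂ D q ≤ √(n * d * p) * Consts.Cq q * c.K₂ D q := by
  have h : (1 : ℝ) ≤ d := by exact_mod_cast hd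
  have h1 : (n * p : ℝ) ≤ n * d * p := by
    have := mul_le_mul_of_nonneg_left h (by positivity : (0 : ℝ) ≤ n * p)
    linarith
  have h2 : 0 ≤ Consts.Cq q := by
    unfold Consts.Cq
    positivity
  exact mul_le_mul_of_nonneg_right (mul_le_mul_of_nonneg_right (Real.sqrt_le_sqrt h1) h2)
    (hc.K₂_nonneg D)

theorem ofTuple_zero_mem_paramSpace : (Param.ofTuple 0 : Param d p q) ∈ c.paramSpace d p q :=
  ⟨norm_zero.trans_le hc.BΦ_nonneg, fun _ => norm_zero.trans_le hc.BA_nonneg,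
    fun _ => norm_zero.trans_le hc.Bb_nonneg, norm_zero.trans_le hc.BA_nonneg,
    norm_zero.trans_le hc.Bb_nonneg, norm_zero.trans_le hc.BU_nonneg,
    norm_zero.trans_le hc.Bv_nonneg⟩

theorem complexity_pos (hd : 1 ≤ d) (hp : 1 ≤ p) (hn : 1 ≤ n) (hnM : 1 / √n ≤ 2 * c.M D q)
    (hnK : 1 / √n ≤ (4 * q + 6) * √p * c.K₂ D q) : 0 < c.complexity D q n d p := by
  have h1 := Consts.two_le_K₁ hn hnM
  have h2 := Consts.two_le_K₂ hn hnK
  have h3 := h2.trans (hc.K₂_le_K₂ (D := D) hd)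
  have hp0 : (0 : ℝ) < p := by exact_mod_cast hp
  have hq0 : (0 : ℝ) ≤ (q : ℝ) - 1 := sub_nonneg.2 (by exact_mod_cast hc.one_le_q)
  have e1 : 0 < c.U₁ D q n := Real.log_pos (by linarith)
  have e2 : 0 ≤ c.U₂ D q n p := Real.log_nonneg (by linarith)
  have e3 : 0 ≤ c.U₃ D q n d p := Real.log_nonneg (by linarith)
  unfold Consts.complexity
  positivity

/-- At the dyadic scales `M / 2 ^ (k + 1)` the parameter space has nets whose logarithmic size grows
linearly in `k`. -/
theorem exists_param_net_dyadic (hd : 1 ≤ d) (hp : 1 ≤ p) (hn : 1 ≤ n)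
    (hnM : 1 / √n ≤ 2 * c.M D q) (hnK : 1 / √n ≤ (4 * q + 6) * √p * c.K₂ D q) (k : ℕ) :
    ∃ S : Finset (Param d p q), S.Nonempty ∧ ↑S ⊆ c.paramSpace d p q ∧
      (∀ θ ∈ c.paramSpace d p q, ∃ θ' ∈ S, ∀ x ∈ AdmissibleSeries D c.Lx c.Bx,
        |θ.predict σ D x - θ'.predict σ D x| ≤ c.M D q / 2 ^ (k + 1)) ∧
      Real.log S.card ≤ (k + 3) * c.complexity D q n d p := by
  have hM := Consts.M_pos hn hnM
  obtain ⟨S, hS0, hS, hnet, hcard⟩ := hc.exists_param_net d p D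
    (e := c.M D q / 2 ^ (k + 1)) (by positivity)
  refine ⟨S, hS0, hS, hnet, ?_⟩
  have hn0 : (0 : ℝ) < n := by exact_mod_cast hn
  have hp0 : (1 : ℝ) ≤ p := by exact_mod_cast hp
  have h1 := Consts.two_le_K₁ hn hnM
  have h2 := Consts.two_le_K₂ hn hnK
  have h3 := hc.K₂_le_K₂ (D := D) (n := n) (p := p) hd
  have hC : 0 ≤ Consts.Cq q := by
    unfold Consts.Cq
    positivity
  -- The first sample-size condition reads `1 / M ≤ 2 √n`; together with the factors `2` and `2 q +
  -- 3` this produces `Cq = 4 (2 q + 3)`.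
  have hscale : ∀ {κ : ℝ}, 0 ≤ κ → 2 * κ / (c.M D q / 2 ^ (k + 1) / (2 * q + 3)) ≤
      2 ^ (k + 1) * (√n * Consts.Cq q * κ) := fun {κ} hκ => by
    have hinv : 1 ≤ 2 * √n * c.M D q := by
      rw [div_le_iff₀ (by positivity)] at hnM
      linarith
    rw [div_div, div_div_eq_mul_div, div_le_iff₀ hM]
    have h := mul_le_mul_of_nonneg_left hinv
      (by positivity : 0 ≤ 2 * κ * (2 ^ (k + 1) * (2 * q + 3)))
    unfold Consts.Cq
    linarith
  have hlog : ∀ {κ y : ℝ}, 0 ≤ κ → √n * Consts.Cq q * κ ≤ y → 2 ≤ y →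
      Real.log (1 + 2 * κ / (c.M D q / 2 ^ (k + 1) / (2 * q + 3))) ≤ (k + 3) * Real.log y := by
    intro κ y hκ hy hy2
    have h := log_one_add_two_pow_mul_le hy2 (k + 1)
    push_cast at h
    calc _ ≤ Real.log (1 + 2 ^ (k + 1) * y) := by
          refine Real.log_le_log (by positivity) (add_le_add_right ((hscale hκ).trans ?_) _)
          gcongr
      _ ≤ _ := h
      _ = _ := by ring
  -- The argument with `√n` alone would suffice as a bound here; the factors `√p` and `√(d p)`
  -- inside `U₂` and `U₃` only enlarge it.
  have hsq : √n * Consts.Cq q * c.K₂ D q ≤ √(n * p) * Consts.Cq q * c.K₂ D q := by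
    have := hc.K₂_nonneg D
    gcongr
    exact le_mul_of_one_le_right hn0.le hp0
  have l1 := hlog (hc.K₁_nonneg D) le_rfl h1
  have l2 := hlog (hc.K₂_nonneg D) hsq h2
  have l3 := hlog (hc.K₂_nonneg D) (hsq.trans h3) (h2.trans h3)
  have hq1 : ((q - 1 : ℕ) : ℝ) = q - 1 := by
    have := hc.one_le_q
    push_cast [this]
    ring
  have hq0 : (0 : ℝ) ≤ (q : ℝ) - 1 := hq1 ▸ Nat.cast_nonneg _
  have hK₁ := hc.K₁_nonneg D
  have hK₂ := hc.K₂_nonneg D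
  have hpos₁ : 0 < 1 + 2 * c.K₁ D q / (c.M D q / 2 ^ (k + 1) / (2 * q + 3)) := by positivity
  have hpos₂ : 0 < 1 + 2 * c.K₂ D q / (c.M D q / 2 ^ (k + 1) / (2 * q + 3)) := by positivity
  have hS1 : (0 : ℝ) < S.card := by exact_mod_cast hS0.card_pos
  refine (Real.log_le_log hS1 hcard).trans ?_
  rw [Real.log_mul (by positivity) (by positivity), Real.log_mul (by positivity) (by positivity),
    Real.log_pow, Real.log_pow, Real.log_pow]
  push_cast
  rw [hq1]
  have m1 := mul_le_mul_of_nonneg_left l1 (by positivity : (0 : ℝ) ≤ 2 * p)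
  have m2 := mul_le_mul_of_nonneg_left l2 (by positivity : (0 : ℝ) ≤ ((q : ℝ) - 1) * p * (p + 1))
  have m3 := mul_le_mul_of_nonneg_left l3 (by positivity : (0 : ℝ) ≤ d * p * (2 + p))
  rw [Consts.complexity, Consts.U₁, Consts.U₂, Consts.U₃]
  linarith

end Regular

end ParamNets

/-! ### The generalization bound -/

section Risks

variable {d p q K n : ℕ} {σ : ℝ → ℝ} {c : Consts} {D : Grid K}

/-- The outcomes bounded by `By` paired with admissible series. -/
def admissibleData (d : ℕ) (c : Consts) (D : Grid K) (By : ℝ) :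
    Set (ℝ × (Fin (K + 1) → Vec d)) :=
  {e | |e.1| ≤ By ∧ e.2 ∈ AdmissibleSeries D c.Lx c.Bx}

theorem measurableSet_admissibleData (d : ℕ) (c : Consts) (D : Grid K) (By : ℝ) :
    MeasurableSet (admissibleData d c D By) := by
  have h : MeasurableSet {e : ℝ × (Fin (K + 1) → Vec d) | |e.1| ≤ By} :=
    measurableSet_le (by fun_prop) measurable_const
  exact h.inter (measurable_snd (measurableSet_admissibleSeries D c.Lx c.Bx))

open Classical in
/-- The loss of the prediction, set to `0` off the admissible data and the parameter space. -/
noncomputable def truncatedLoss (c : Consts) (σ : ℝ → ℝ) (D : Grid K) (By : ℝ)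
    (loss : ℝ → ℝ → ℝ) (θ : Param d p q) (e : ℝ × (Fin (K + 1) → Vec d)) : ℝ :=
  if θ ∈ c.paramSpace d p q then
    (admissibleData d c D By).indicator (fun e => loss e.1 (θ.predict σ D e.2)) e
  else 0

variable {By Lℓ Mℓ : ℝ} {loss : ℝ → ℝ → ℝ}

theorem truncatedLoss_of_mem {θ : Param d p q} (hθ : θ ∈ c.paramSpace d p q)
    {e : ℝ × (Fin (K + 1) → Vec d)} (he : e ∈ admissibleData d c D By) :
    truncatedLoss c σ D By loss θ e = loss e.1 (θ.predict σ D e.2) := by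
  rw [truncatedLoss, if_pos hθ, Set.indicator_of_mem he]

theorem truncatedLoss_of_notMem (θ : Param d p q) {e : ℝ × (Fin (K + 1) → Vec d)}
    (he : e ∉ admissibleData d c D By) : truncatedLoss c σ D By loss θ e = 0 := by
  rw [truncatedLoss, Set.indicator_of_notMem he, ite_self]

theorem measurable_truncatedLoss (hσ : Continuous σ) (hloss : Measurable (Function.uncurry loss))
    (θ : Param d p q) : Measurable (truncatedLoss c σ D By loss θ) := by
  by_cases hθ : θ ∈ c.paramSpace d p q
  · have : truncatedLoss c σ D By loss θ =
        (admissibleData d c D By).indicator fun e => loss e.1 (θ.predict σ D e.2) := by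
      funext e
      rw [truncatedLoss, if_pos hθ]
    rw [this]
    exact (hloss.comp (measurable_fst.prodMk ((continuous_predict hσ θ).measurable.comp
      measurable_snd))).indicator (measurableSet_admissibleData d c D By)
  · have : truncatedLoss c σ D By loss θ = fun _ => 0 := by
      funext e
      rw [truncatedLoss, if_neg hθ]
    rw [this]
    exact measurable_const

theorem truncatedLoss_nonneg (hloss : ∀ a u, 0 ≤ loss a u) (θ : Param d p q)
    (e : ℝ × (Fin (K + 1) → Vec d)) : 0 ≤ truncatedLoss c σ D By loss θ e := by
  unfold truncatedLoss
  split_ifs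
  · exact Set.indicator_nonneg (fun _ _ => hloss _ _) _
  · exact le_rfl

theorem truncatedLoss_le (hc : Regular c σ q) (hMℓ : 0 ≤ Mℓ)
    (hbdd : ∀ a u : ℝ, |a| ≤ By → |u| ≤ c.M D q → loss a u ≤ Mℓ) (θ : Param d p q)
    (e : ℝ × (Fin (K + 1) → Vec d)) : truncatedLoss c σ D By loss θ e ≤ Mℓ := by
  by_cases hθ : θ ∈ c.paramSpace d p q
  · by_cases he : e ∈ admissibleData d c D By
    · rw [truncatedLoss_of_mem hθ he]
      exact hbdd _ _ he.1 (hc.abs_predict_le hθ he.2)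
    · rwa [truncatedLoss_of_notMem θ he]
  · rwa [truncatedLoss, if_neg hθ]

theorem abs_truncatedLoss_sub_le (hc : Regular c σ q) (hLℓ : 0 ≤ Lℓ)
    (hlip : ∀ a u w : ℝ, |a| ≤ By → |u| ≤ c.M D q → |w| ≤ c.M D q →
      |loss a u - loss a w| ≤ Lℓ * |u - w|) {θ θ' : Param d p q}
    (hθ : θ ∈ c.paramSpace d p q) (hθ' : θ' ∈ c.paramSpace d p q) {r : ℝ} (hr : 0 ≤ r)
    (h : ∀ x ∈ AdmissibleSeries D c.Lx c.Bx, |θ.predict σ D x - θ'.predict σ D x| ≤ r)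
    (e : ℝ × (Fin (K + 1) → Vec d)) :
    |truncatedLoss c σ D By loss θ e - truncatedLoss c σ D By loss θ' e| ≤ Lℓ * r := by
  by_cases he : e ∈ admissibleData d c D By
  · rw [truncatedLoss_of_mem hθ he, truncatedLoss_of_mem hθ' he]
    exact (hlip _ _ _ he.1 (hc.abs_predict_le hθ he.2) (hc.abs_predict_le hθ' he.2)).trans
      (mul_le_mul_of_nonneg_left (h _ he.2) hLℓ)
  · rw [truncatedLoss_of_notMem θ he, truncatedLoss_of_notMem θ' he, sub_self, abs_zero]
    positivity

/-- The uniform deviation bound over the parameter space, for the law `ν` of the data. -/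
theorem Regular.exists_measurableSet_deviation_le (hc : Regular c σ q) (hd : 1 ≤ d) (hp : 1 ≤ p)
    (hn : 1 ≤ n) (hloss : Measurable (Function.uncurry loss)) (hnonneg : ∀ a u, 0 ≤ loss a u)
    (hLℓ : 0 ≤ Lℓ) (hMℓ : 0 ≤ Mℓ)
    (hlip : ∀ a u w : ℝ, |a| ≤ By → |u| ≤ c.M D q → |w| ≤ c.M D q →
      |loss a u - loss a w| ≤ Lℓ * |u - w|)
    (hbdd : ∀ a u : ℝ, |a| ≤ By → |u| ≤ c.M D q → loss a u ≤ Mℓ)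
    (hnM : 1 / √n ≤ 2 * c.M D q) (hnK : 1 / √n ≤ (4 * q + 6) * √p * c.K₂ D q)
    (ν : Measure (ℝ × (Fin (K + 1) → Vec d))) [IsProbabilityMeasure ν]
    {δ : ℝ} (hδ0 : 0 < δ) (hδ1 : δ < 1) :
    ∃ A : Set (Fin n → ℝ × (Fin (K + 1) → Vec d)), MeasurableSet A ∧
      ENNReal.ofReal (1 - δ) ≤ (Measure.pi fun _ => ν) A ∧
      ∀ z ∈ A, ∀ θ ∈ c.paramSpace d p q,
        deviation ν (truncatedLoss c σ D By loss) θ z ≤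
          24 * c.M D q * Lℓ / √n * √(c.complexity D q n d p) +
            Mℓ * √(Real.log (1 / δ) / (2 * n)) := by
  have hM := hc.M_nonneg D
  let θ₀ : Param d p q := Param.ofTuple 0
  have hθ₀ : θ₀ ∈ c.paramSpace d p q := hc.ofTuple_zero_mem_paramSpace
  -- The zero parameter lies within `M` of every prediction, so the coarsest net is a singleton; the
  -- dyadic nets follow, shifted by one index.
  have hpred₀ : ∀ x, θ₀.predict σ D x = 0 := fun x => by
    rw [predict_eq_inner_latentState]
    exact inner_zero_left _
  choose S hS0 hSΘ hSnet hScard using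
    hc.exists_param_net_dyadic (d := d) (p := p) (D := D) hd hp hn hnM hnK
  have key := NCDE.exists_measurableSet_deviation_le ν (n := n) hn
    (g := truncatedLoss (d := d) (p := p) (q := q) c σ D By loss)
    (measurable_truncatedLoss hc.continuous hloss)
    (truncatedLoss_nonneg hnonneg) (truncatedLoss_le hc hMℓ hbdd)
    (T := c.paramSpace d p q) (S := fun k => Nat.casesOn k {θ₀} S) (θ₀ := θ₀) (r := Lℓ * c.M D q)
    (Λ := c.complexity D q n d p) (fun k => by cases k; exacts [Finset.singleton_nonempty _, hS0 _])
    (fun k => by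
      cases k
      · simpa using hθ₀
      · exact hSΘ _)
    rfl (by positivity) (fun k θ hθ => by
      cases k with
      | zero =>
        refine ⟨θ₀, Finset.mem_singleton_self _, fun e => ?_⟩
        rw [pow_zero, div_one]
        refine abs_truncatedLoss_sub_le hc hLℓ hlip hθ hθ₀ hM (fun x hx => ?_) e
        rw [hpred₀, sub_zero]
        exact hc.abs_predict_le hθ hx
      | succ k =>
        obtain ⟨θ', hθ', h⟩ := hSnet k θ hθ
        refine ⟨θ', hθ', fun e => ?_⟩
        rw [mul_div_assoc]
        exact abs_truncatedLoss_sub_le hc hLℓ hlip hθ (hSΘ k hθ') (by positivity) h e)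
    (hc.complexity_pos hd hp hn hnM hnK) hScard hδ0 hδ1
  obtain ⟨A, hA, hPA, h⟩ := key
  refine ⟨A, hA, hPA, fun z hz θ hθ => (h z hz θ hθ).trans (le_of_eq ?_)⟩
  ring

end Risks

end NCDE

/-- The deviation bound for the product law is pulled back along the sample. Being uniform over `Θ`,
it applies at the data-dependent `θhat ω`. -/
theorem theorem1
    {Ω : Type*} [MeasurableSpace Ω] (P : Measure Ω) [IsProbabilityMeasure P]
    {d p q K n : ℕ} (hd : 1 ≤ d) (hp : 1 ≤ p) (hq : 1 ≤ q)
    (D : NCDE.Grid K) (c : NCDE.Consts)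
    (hLσ : 1 ≤ c.Lσ) (hLx : 0 ≤ c.Lx) (hBx : 0 ≤ c.Bx) (hBΦ : 0 ≤ c.BΦ) (hBA : 0 ≤ c.BA)
    (hBb : 0 ≤ c.Bb) (hBU : 0 ≤ c.BU) (hBv : 0 ≤ c.Bv)
    -- the activation function
    (σ : ℝ → ℝ) (hσ : ∀ u w, |σ u - σ w| ≤ c.Lσ * |u - w|) (hσ0 : σ 0 = 0)
    -- the generic outcome and path, and the sample
    (y : Ω → ℝ) (x : Ω → ℝ → NCDE.Vec d)
    (Y : Fin n → Ω → ℝ) (X : Fin n → Ω → ℝ → NCDE.Vec d)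
    (hindep : iIndepFun (fun i ω => (Y i ω, D.sample (X i ω))) P)
    (hident : ∀ i, IdentDistrib (fun ω => (Y i ω, D.sample (X i ω)))
      (fun ω => (y ω, D.sample (x ω))) P P)
    (hX : ∀ i, ∀ᵐ ω ∂P, NCDE.IsAdmissiblePath c.Lx c.Bx (X i ω))
    (By : ℝ) (hy : ∀ᵐ ω ∂P, |y ω| ≤ By)
    -- the loss function
    (loss : ℝ → ℝ → ℝ) (hmeas : Measurable (Function.uncurry loss))
    (hnonneg : ∀ a u, 0 ≤ loss a u) (Lℓ Mℓ : ℝ) (hLℓ : 0 ≤ Lℓ)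
    (hlip : ∀ a u w : ℝ, |a| ≤ By → |u| ≤ c.M D q → |w| ≤ c.M D q →
      |loss a u - loss a w| ≤ Lℓ * |u - w|)
    (hbdd : ∀ a u : ℝ, |a| ≤ By → |u| ≤ c.M D q → loss a u ≤ Mℓ)
    -- the sample is large enough: `1 / √n` is small compared to the constants
    (hnM : 1 / √n ≤ 2 * c.M D q) (hnK : 1 / √n ≤ (4 * q + 6) * √p * c.K₂ D q)
    (hn : 1 ≤ n)
    -- an empirical risk minimizer
    (θhat : Ω → NCDE.Param d p q)
    (hθhat : ∀ᵐ ω ∂P, θhat ω ∈ c.paramSpace d p q ∧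
      ∀ θ ∈ c.paramSpace d p q,
        NCDE.empRisk D σ loss (fun i => Y i ω) (fun i => D.sample (X i ω)) (θhat ω) ≤
          NCDE.empRisk D σ loss (fun i => Y i ω) (fun i => D.sample (X i ω)) θ)
    (δ : ℝ) (hδ0 : 0 < δ) (hδ1 : δ < 1) :
    ENNReal.ofReal (1 - δ) ≤ P {ω |
      NCDE.risk P D σ loss y (fun ω' => D.sample (x ω')) (θhat ω) -
          NCDE.empRisk D σ loss (fun i => Y i ω) (fun i => D.sample (X i ω)) (θhat ω) ≤
        24 * c.M D q * Lℓ / √n * √(c.complexity D q n d p) +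
          Mℓ * √(Real.log (1 / δ) / (2 * n))} := by
  have hc : NCDE.Regular c σ q := ⟨hq, hLσ, hLx, hBx, hBΦ, hBA, hBb, hBU, hBv, hσ, hσ0⟩
  have hξm : AEMeasurable (fun ω => (y ω, D.sample (x ω))) P := (hident ⟨0, hn⟩).aemeasurable_snd
  have hZm : ∀ i, AEMeasurable (fun ω => (Y i ω, D.sample (X i ω))) P :=
    fun i => (hident i).aemeasurable_fst
  set ν := P.map fun ω => (y ω, D.sample (x ω)) with hν
  have : IsProbabilityMeasure ν := Measure.isProbabilityMeasure_map hξm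
  have hlaw : ∀ i, P.map (fun ω => (Y i ω, D.sample (X i ω))) = ν := fun i => (hident i).map_eq
  have hjoint : P.map (fun ω i => (Y i ω, D.sample (X i ω))) = Measure.pi fun _ => ν := by
    rw [(iIndepFun_iff_map_fun_eq_pi_map hZm).1 hindep]
    simp only [hlaw]
  have hGm := NCDE.measurableSet_admissibleData d c D By
  have hGν : ∀ᵐ e ∂ν, e ∈ NCDE.admissibleData d c D By := by
    have h1 : ∀ᵐ e ∂ν, |e.1| ≤ By :=
      (ae_map_iff hξm (measurableSet_le (by fun_prop) measurable_const)).2 hy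
    have h2 : ∀ᵐ e ∂ν, e.2 ∈ NCDE.AdmissibleSeries D c.Lx c.Bx := by
      -- Admissibility is assumed for the sampled paths; it passes to the generic series through the
      -- common law, and the bound on `y` passes to the sample in the same way.
      rw [← hlaw ⟨0, hn⟩]
      refine (ae_map_iff (hZm _)
        (measurable_snd (NCDE.measurableSet_admissibleSeries D c.Lx c.Bx))).2 ?_
      filter_upwards [hX ⟨0, hn⟩] with ω hω using hω.sample_mem
    filter_upwards [h1, h2] with e h1 h2 using ⟨h1, h2⟩
  have hGξ : ∀ᵐ ω ∂P, (y ω, D.sample (x ω)) ∈ NCDE.admissibleData d c D By :=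
    ae_of_ae_map hξm hGν
  have hGZ : ∀ᵐ ω ∂P, ∀ i, (Y i ω, D.sample (X i ω)) ∈ NCDE.admissibleData d c D By :=
    ae_all_iff.2 fun i => ae_of_ae_map (hZm i) (by rw [hlaw i]; exact hGν)
  have hMℓ : 0 ≤ Mℓ := by
    obtain ⟨ω, hω⟩ := hy.exists
    exact (hnonneg (y ω) 0).trans (hbdd _ _ hω (by simpa using hc.M_nonneg D))
  obtain ⟨A, hA, hPA, hdev⟩ := hc.exists_measurableSet_deviation_le hd hp hn hmeas hnonneg hLℓ hMℓ
    hlip hbdd hnM hnK ν hδ0 hδ1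
  rw [← hjoint, Measure.map_apply_of_aemeasurable (aemeasurable_pi_lambda _ hZm) hA] at hPA
  -- The target event need not be measurable: it almost surely contains the preimage of the
  -- measurable set `A`.
  refine hPA.trans (measure_mono_ae ?_)
  filter_upwards [hGZ, hθhat] with ω hω hθ hωA
  have h := hdev _ hωA _ hθ.1
  have hrisk : NCDE.risk P D σ loss y (fun ω' => D.sample (x ω')) (θhat ω) =
      ∫ e, NCDE.truncatedLoss c σ D By loss (θhat ω) e ∂ν := by
    rw [hν, integral_map hξm
      (NCDE.measurable_truncatedLoss hc.continuous hmeas _).aestronglyMeasurable, NCDE.risk]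
    refine integral_congr_ae ?_
    filter_upwards [hGξ] with ω' hω'
    rw [NCDE.truncatedLoss_of_mem hθ.1 hω']
  have hemp : NCDE.empRisk D σ loss (fun i => Y i ω) (fun i => D.sample (X i ω)) (θhat ω) =
      (1 / (n : ℝ)) * ∑ i, NCDE.truncatedLoss c σ D By loss (θhat ω)
        (Y i ω, D.sample (X i ω)) := by
    rw [NCDE.empRisk]
    congr 1
    refine Finset.sum_congr rfl fun i _ => ?_
    rw [NCDE.truncatedLoss_of_mem hθ.1 (hω i)]
  change _ - _ ≤ _
  rw [hrisk, hemp]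
  exact h
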